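/- **Setting.** Let $T>0$, $g\in\mathbb R$. Let $\mathcal D\subset\mathbb R^2$ be a bounded, open, connected set which for every $t\in[0,T)$ is the disjoint union $\mathcal D=\Omega^+(t)\cup\Gamma(t)\cup\Omega^-(t)$, where $\Omega^\pm(t)$ are open (with $\Omega^\pm=\Omega^\pm(0)$ connected and $\Gamma=\Gamma(0)=\overline{\Omega^+}\cap\overline{\Omega^-}$), and $\Gamma(t)$ is a closed, non-self-intersecting curve of class $W^{4,\infty}$ such that $\Omega^+(t)$ and $\Omega^-(t)$ both lie locally on one side of $\Gamma(t)$. Let $\mathcal N$ be the unit normal to $\Gamma(t)$ pointing into $\Omega^-(t)$, $\mathcal T$ the unit tangent with $\mathcal N=\mathcal T^\perp$, $(x_1,x_2)^\perp=(-x_2,x_1)$, $\nabla_{\mathcal T}$ the tangential (arclength) derivative along $\Gamma(t)$, and $H$ the curvature of $\Gamma(t)$, $\nabla_{\mathcal T}\mathcal N=H\mathcal T$. Let $(u^\pm,p^\pm)$ be a classical solution on $[0,T)$ of the irrotational incompressible two-fluid Euler equations with unit densities and unit surface tension, $$u^\pm_t+u^\pm\cdot Du^\pm+Dp^\pm=-g\,\mathrm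 e_2,\qquad \operatorname{curl}u^\pm=0,\quad \operatorname{div}u^\pm=0\qquad\text{in }\Omega^\pm(t),$$ $$p^+-p^-=H,\qquad (u^+-u^-)\cdot\mathcal N=0\quad\text{on }\Gamma(t),\qquad u^-\cdot N=0\quad\text{on }\partial\mathcal D,$$ with $\Gamma(t)$ moving with normal speed $u^+\cdot\mathcal N$; here $N$ is the outward unit normal to $\partial\mathcal D$, wherever it exists. Classical means that $u^\pm$ is $C^1$ in $(x,t)$ up to the boundary of $\Omega^\pm(t)$, $t\in[0,T)$, that $p^\pm(\cdot,t)$ is $C^1$ up to the boundary of $\Omega^\pm(t)$, and that the Lagrangian flow map $\eta$ of $u^-$ on $\overline{\Omega^-}$ ($\eta(x,0)=x$, $\partial_t\eta(x,t)=u^-(\eta(x,t),t)$, $\eta(\Gamma,t)=\Gamma(t)$) is $C^1$ on $\Gamma\times[0,T)$. Set $\delta u=u^+-u^-$ on $\Gamma(t)$ and $\|f\|_{W^{k,\infty}(\Gamma(t))}=\sum_{i=0}^k\|\nabla^i_{\mathcal T}f\|_{L^\infty(\Gamma(t))}$. **Assumptions.** There is $\mathcal M<\infty$ with $$\sup_{t\in[0,T)}\left(\|u^+(\cdot,t)\|_{W^{2,\infty}(\Gamma(t))}+\|H(\cdot,t)\|_{W^{2,\infty}(\Gamma(t))}\right)<\mathcal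 M ,$$ and there is a sequence $t_n\to T$, $t_n\in[0,T)$, with $$\max_{x\in\Gamma}\left|[\nabla_{\mathcal T}\delta u\cdot\mathcal T](\eta(x,t_n),t_n)\right|\to\infty .$$ **Conclusion.** On $\Gamma(t)$ put $\mathfrak A=2\,\nabla_{\mathcal T}u^+\cdot\mathcal T$ and $\mathcal A=(\delta u\cdot\mathcal T)\,\nabla_{\mathcal T}(\nabla_{\mathcal T}u^+\cdot\mathcal T)+\nabla_{\mathcal T}(\nabla_{\mathcal T}H)$. Then $$c_6:=\sup_{t\in[0,T)}\big\|\,|\mathfrak A|+|\mathcal A|\,\big\|_{L^\infty(\Gamma(t))}<\infty ,$$ and for every $0<\epsilon\le T$ there is $t_0(\epsilon)\in[T-\epsilon,T)$ such that $$\|\nabla_{\mathcal T}u^-\cdot\mathcal T(\cdot,t)\|_{L^\infty(\Gamma(t))}\le\frac{1+(1+2c_6)(T-t)}{T-t}\qquad\text{for all }t\in[t_0(\epsilon),T).$$ -/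

import Mathlib

open MeasureTheory Set Filter Topology
open scoped ENNReal

noncomputable section

/-- The plane `ℝ²` with its Euclidean structure. -/
abbrev Plane : Type := EuclideanSpace ℝ (Fin 2)

namespace VortexSheet

/-! ### Calculus on a parametrized closed curve

A closed curve is given by a `1`-periodic regular `C¹` parametrization `c : ℝ → Plane`; a function
`f` on the curve is represented by its pullback to the parameter `s`. -/

section Curve

variable {E : Type*} [NormedAddCommGroup E] [NormedSpace ℝ E]

/-- Rotation by a right angle, `x^⊥ = (-x₂, x₁)`. -/
def perp (x : Plane) : Plane := !₂[-x 1, x 0]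

/-- The tangential derivative `∇_T f = G f'` along the curve `c`, where `G = 1 / |c'|`
(the derivative with respect to arclength). -/
def tanDeriv (c : ℝ → Plane) (f : ℝ → E) : ℝ → E := fun s => ‖deriv c s‖⁻¹ • deriv f s

/-- The unit tangent `τ = G c'`. -/
def unitTangent (c : ℝ → Plane) : ℝ → Plane := tanDeriv c c

/-- The unit normal `n = τ^⊥`. -/
def unitNormal (c : ℝ → Plane) : ℝ → Plane := fun s => perp (unitTangent c s)

/-- The curvature `H`: the derivative of the unit normal is `∇_T n = H τ`, that is,
`∇_T τ = - H n`. It is positive on a circle whose unit normal points outward. -/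
def curvature (c : ℝ → Plane) : ℝ → ℝ :=
  fun s => - inner ℝ (tanDeriv c (unitTangent c) s) (unitNormal c s)

/-- Membership in `W^{k,∞}` of the curve, for `k ≥ 1`: the tangential derivatives of order
`< k` are Lipschitz (so that those of order `< k` exist classically and the one of order `k`
exists almost everywhere and is essentially bounded). -/
def MemW (k : ℕ) (c : ℝ → Plane) (f : ℝ → E) : Prop :=
  ∀ i < k, ∃ K : NNReal, LipschitzWith K ((tanDeriv c)^[i] f)

/-- The norm `∑_{i ≤ k} ‖∇_T^i f‖_{L^∞}` of `W^{k,∞}` of the curve. -/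
def wNorm (k : ℕ) (c : ℝ → Plane) (f : ℝ → E) : ℝ≥0∞ :=
  ∑ i ∈ Finset.range (k + 1), eLpNorm ((tanDeriv c)^[i] f) ∞ volume

end Curve

/-! ### Domains and regularity up to the boundary -/

/-- `f` is `C¹` on `S` (typically a closed domain, so that this is `C¹` up to the boundary):
it is differentiable relative to `S` at every point of `S`, with a derivative that is continuous
on `S`. -/
def IsC1On {X Y : Type*} [NormedAddCommGroup X] [NormedSpace ℝ X]
    [NormedAddCommGroup Y] [NormedSpace ℝ Y] (f : X → Y) (S : Set X) : Prop :=
  ∃ f' : X → (X →L[ℝ] Y), ContinuousOn f' S ∧ ∀ q ∈ S, HasFDerivWithinAt f (f' q) S q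

/-- `ν` is the outward unit normal of `Ω` at the boundary point `x`; in particular `Ω` lies locally
on one side of its boundary near `x`. -/
def IsOutwardUnitNormal (Ω : Set Plane) (x ν : Plane) : Prop :=
  ‖ν‖ = 1 ∧
  (∀ w : Plane, inner ℝ w ν < 0 → ∀ᶠ h : ℝ in 𝓝[>] 0, x + h • w ∈ Ω) ∧
  (∀ w : Plane, 0 < inner ℝ w ν → ∀ᶠ h : ℝ in 𝓝[>] 0, x + h • w ∉ Ω)

/-- The open space-time region swept by `Ω t`, `0 < t < T`. -/
def spaceTime (T : ℝ) (Ω : ℝ → Set Plane) : Set (ℝ × Plane) :=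
  {q | q.1 ∈ Ioo 0 T ∧ q.2 ∈ Ω q.1}

/-- The space-time region swept by the closures of `Ω t`, `0 ≤ t < T`. -/
def closedSpaceTime (T : ℝ) (Ω : ℝ → Set Plane) : Set (ℝ × Plane) :=
  {q | q.1 ∈ Ico 0 T ∧ q.2 ∈ closure (Ω q.1)}

/-- The partial derivative `∂ u_j / ∂ x_i` of a planar vector field. -/
def partialD (u : Plane → Plane) (i j : Fin 2) (x : Plane) : ℝ :=
  (fderiv ℝ u x (EuclideanSpace.single i 1)) j

/-- Divergence of a planar vector field. -/
def div (u : Plane → Plane) (x : Plane) : ℝ := partialD u 0 0 x + partialD u 1 1 x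

/-- Scalar curl of a planar vector field. -/
def curl (u : Plane → Plane) (x : Plane) : ℝ := partialD u 0 1 x - partialD u 1 0 x

/-- The vertical unit vector. -/
def e₂ : Plane := EuclideanSpace.single 1 1

/-- The momentum equation `u_t + u · Du + Dp = - g e₂` (unit density) at time `t` and place `x`. -/
def MomentumAt (g : ℝ) (u : ℝ → Plane → Plane) (p : ℝ → Plane → ℝ) (t : ℝ) (x : Plane) : Prop :=
  deriv (fun r => u r x) t + fderiv ℝ (u t) x (u t x) + gradient (p t) x = -(g • e₂)

/-! ### Two-fluid flows -/

/-- The unknowns of a planar two-fluid flow: container, the two fluid regions, velocities and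
pressures, a parametrization `θ` of the initial interface, and the Lagrangian flow map `η` of the
velocity `um`. The suffixes `p` and `m` stand for the superscripts `+` and `-`. -/
structure Flow where
  D : Set Plane
  Ωp : ℝ → Set Plane
  Ωm : ℝ → Set Plane
  up : ℝ → Plane → Plane
  um : ℝ → Plane → Plane
  pp : ℝ → Plane → ℝ
  pm : ℝ → Plane → ℝ
  θ : ℝ → Plane
  η : ℝ → Plane → Plane

namespace Flow

variable (F : Flow)

/-- The Lagrangian parametrization `s ↦ η(θ(s), t)` of the interface `Γ(t)`. -/
def z (t : ℝ) : ℝ → Plane := fun s => F.η t (F.θ s)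

/-- The interface `Γ(t)`. -/
def Γ (t : ℝ) : Set Plane := range (F.z t)

/-- The unit tangent `τ` at `η(θ(s), t)`. -/
def τ (t : ℝ) : ℝ → Plane := unitTangent (F.z t)

/-- The unit normal `n` at `η(θ(s), t)`. -/
def n (t : ℝ) : ℝ → Plane := unitNormal (F.z t)

/-- The curvature `H` of `Γ(t)` at `η(θ(s), t)`. -/
def H (t : ℝ) : ℝ → ℝ := curvature (F.z t)

/-- `v⁺ = u⁺ ∘ η` on the interface. -/
def vp (t : ℝ) : ℝ → Plane := fun s => F.up t (F.z t s)

/-- `v⁻ = u⁻ ∘ η` on the interface. -/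
def vm (t : ℝ) : ℝ → Plane := fun s => F.um t (F.z t s)

/-- The velocity jump `δv = v⁺ - v⁻`. -/
def δv (t : ℝ) : ℝ → Plane := fun s => F.vp t s - F.vm t s

/-- `∇_T u⁺ · T`. -/
def stretchP (t : ℝ) : ℝ → ℝ := fun s => inner ℝ (tanDeriv (F.z t) (F.vp t) s) (F.τ t s)

/-- The tangential stretching rate `∇_T u⁻ · T`. -/
def stretchM (t : ℝ) : ℝ → ℝ := fun s => inner ℝ (tanDeriv (F.z t) (F.vm t) s) (F.τ t s)

/-- `∇_T δu · T`. -/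
def stretchJump (t : ℝ) : ℝ → ℝ := fun s => inner ℝ (tanDeriv (F.z t) (F.δv t) s) (F.τ t s)

/-- The coefficient `𝔄 = 2 ∇_T u⁺ · T`. -/
def coeffA (t : ℝ) : ℝ → ℝ := fun s => 2 * F.stretchP t s

/-- The forcing `𝒜 = (δu · T) ∇_T (∇_T u⁺ · T) + ∇_T (∇_T H)`. -/
def forcing (t : ℝ) : ℝ → ℝ := fun s =>
  inner ℝ (F.δv t s) (F.τ t s) * tanDeriv (F.z t) (F.stretchP t) s
    + tanDeriv (F.z t) (tanDeriv (F.z t) (F.H t)) s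

/-- The constant `c₆ = sup_{t, x} (|𝔄| + |𝒜|)`, the supremum over the interface being essential
because `𝒜` is only an `L^∞` function there. -/
def c6 (T : ℝ) : ℝ≥0∞ :=
  ⨆ t ∈ Ico 0 T, eLpNorm (fun s => |F.coeffA t s| + |F.forcing t s|) ∞ volume

/-- `F` is a classical solution on `[0, T)` of the incompressible irrotational two-fluid Euler
equations with gravity `g`, unit densities and unit surface tension, with non-self-intersecting
interface of class `W^{4,∞}`. -/
structure IsSolution (T g : ℝ) : Prop where
  -- geometry of the container and of the initial configuration
  D_open : IsOpen F.D
  D_bounded : Bornology.IsBounded F.D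
  D_connected : IsConnected F.D
  Ωp_connected : IsConnected (F.Ωp 0)
  Ωm_connected : IsConnected (F.Ωm 0)
  Γ_initial : range F.θ = closure (F.Ωp 0) ∩ closure (F.Ωm 0)
  θ_periodic : Function.Periodic F.θ 1
  θ_regular : ContDiff ℝ 1 F.θ ∧ ∀ s, deriv F.θ s ≠ 0
  -- the moving fluid regions and the interface separating them
  Ωp_open : ∀ t ∈ Ico 0 T, IsOpen (F.Ωp t)
  Ωm_open : ∀ t ∈ Ico 0 T, IsOpen (F.Ωm t)
  Ωp_spaceTime : IsOpen (spaceTime T F.Ωp)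
  Ωm_spaceTime : IsOpen (spaceTime T F.Ωm)
  decomposition : ∀ t ∈ Ico 0 T, F.D = F.Ωp t ∪ F.Γ t ∪ F.Ωm t
  disjoint_pm : ∀ t ∈ Ico 0 T, Disjoint (F.Ωp t) (F.Ωm t)
  disjoint_pΓ : ∀ t ∈ Ico 0 T, Disjoint (F.Ωp t) (F.Γ t)
  disjoint_mΓ : ∀ t ∈ Ico 0 T, Disjoint (F.Ωm t) (F.Γ t)
  Γ_simple : ∀ t ∈ Ico 0 T, InjOn (F.z t) (Ico 0 1)
  Γ_class : ∀ t ∈ Ico 0 T, MemW 4 (F.z t) (F.z t)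
  -- the unit normal points into `Ω⁻(t)`; both regions are locally on one side of `Γ(t)`
  normal_p : ∀ t ∈ Ico 0 T, ∀ s, IsOutwardUnitNormal (F.Ωp t) (F.z t s) (F.n t s)
  normal_m : ∀ t ∈ Ico 0 T, ∀ s, IsOutwardUnitNormal (F.Ωm t) (F.z t s) (-F.n t s)
  -- regularity
  up_C1 : IsC1On (fun q : ℝ × Plane => F.up q.1 q.2) (closedSpaceTime T F.Ωp)
  um_C1 : IsC1On (fun q : ℝ × Plane => F.um q.1 q.2) (closedSpaceTime T F.Ωm)
  pp_C1 : ∀ t ∈ Ioo 0 T, IsC1On (F.pp t) (closure (F.Ωp t))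
  pm_C1 : ∀ t ∈ Ioo 0 T, IsC1On (F.pm t) (closure (F.Ωm t))
  -- the Lagrangian flow of `u⁻`
  η_zero : ∀ x ∈ closure (F.Ωm 0), F.η 0 x = x
  η_mem : ∀ t ∈ Ico 0 T, ∀ x ∈ closure (F.Ωm 0), F.η t x ∈ closure (F.Ωm t)
  η_deriv : ∀ t ∈ Ico 0 T, ∀ x ∈ closure (F.Ωm 0),
    HasDerivWithinAt (fun r => F.η r x) (F.um t (F.η t x)) (Ico 0 T) t
  η_C1 : IsC1On (fun q : ℝ × ℝ => F.z q.1 q.2) (Ico 0 T ×ˢ univ)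
  -- the Euler equations
  momentum_p : ∀ t ∈ Ioo 0 T, ∀ x ∈ F.Ωp t, MomentumAt g F.up F.pp t x
  momentum_m : ∀ t ∈ Ioo 0 T, ∀ x ∈ F.Ωm t, MomentumAt g F.um F.pm t x
  curl_p : ∀ t ∈ Ico 0 T, ∀ x ∈ F.Ωp t, curl (F.up t) x = 0
  curl_m : ∀ t ∈ Ico 0 T, ∀ x ∈ F.Ωm t, curl (F.um t) x = 0
  div_p : ∀ t ∈ Ico 0 T, ∀ x ∈ F.Ωp t, div (F.up t) x = 0
  div_m : ∀ t ∈ Ico 0 T, ∀ x ∈ F.Ωm t, div (F.um t) x = 0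
  pressure_jump : ∀ t ∈ Ioo 0 T, ∀ s, F.pp t (F.z t s) - F.pm t (F.z t s) = F.H t s
  normal_jump : ∀ t ∈ Ico 0 T, ∀ s, inner ℝ (F.up t (F.z t s) - F.um t (F.z t s)) (F.n t s) = 0
  wall : ∀ t ∈ Ico 0 T, ∀ x ∈ frontier F.D, ∀ N, IsOutwardUnitNormal F.D x N →
    inner ℝ (F.um t x) N = 0
  normal_speed : ∀ t ∈ Ioo 0 T, ∀ s,
    inner ℝ (deriv (fun r => F.z r s) t) (F.n t s) = inner ℝ (F.up t (F.z t s)) (F.n t s)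

/-- The a priori bound
`sup_{t ∈ [0,T)} (‖u⁺‖_{W^{2,∞}(Γ(t))} + ‖H‖_{W^{2,∞}(Γ(t))}) < M`. -/
def Bounds (T M : ℝ) : Prop :=
  (∀ t ∈ Ico 0 T, MemW 2 (F.z t) (F.vp t) ∧ MemW 2 (F.z t) (F.H t)) ∧
  ⨆ t ∈ Ico 0 T, (wNorm 2 (F.z t) (F.vp t) + wNorm 2 (F.z t) (F.H t)) < ENNReal.ofReal M

/-- The blow-up assumption: `max_Γ |∇_T δu · T| → ∞` along some sequence `t_k → T`. -/
def BlowUp (T : ℝ) : Prop :=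
  ∃ tk : ℕ → ℝ, (∀ k, tk k ∈ Ico 0 T) ∧ Tendsto tk atTop (𝓝 T) ∧
    Tendsto (fun k => ⨆ s, |F.stretchJump (tk k) s|) atTop atTop

end Flow

end VortexSheet

end

/-!
Let `ℓ` be the speed of the Lagrangian parametrization of the interface, `w` the tangential velocity
jump, `a = ∇_T u⁺ · T` and `X = ∇_T δu · T`, so that `∇_T u⁻ · T = a - X`. Since the parametrization
moves with `u⁻`, `ℓ_t = ℓ (a - X)`; since the jump is tangential, `w_s = ℓ X`. Subtracting the
tangential components of the two momentum equations eliminates the pressures through `p⁺ - p⁻ = H`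
and leaves `w_t = -∇_T H - a w`. Formally, differentiating in `s` gives the Riccati inequality
`X_t = X² - 2 a X - 𝒜 ≥ X² - 2 a X + 2 |a| - c₆`. Two families of strict subsolutions serve as
barriers: constants `-C` bound `X` from below, and `t ↦ 1 / (S - t) + c₆ + 1`, with `S < T`, would
force `X` to blow up at time `S` if `X t` exceeded `1 / (T - t) + c₆ + 1`. As `w_t` is only
Lipschitz in `s`, `X` need not be differentiable in time, and the comparison is made for the lower
right difference quotients of `w_s = ℓ X`.
-/

namespace VortexSheet

section RealAnalysis

variable {E : Type*} [NormedAddCommGroup E] [NormedSpace ℝ E]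

theorem hasDerivAt_of_lipschitzWith_of_continuous_deriv [FiniteDimensional ℝ E] {K : NNReal}
    {f : ℝ → E} (hf : LipschitzWith K f) (hc : Continuous (deriv f)) (x : ℝ) :
    HasDerivAt f (deriv f x) x := by
  have hint (y : ℝ) : HasDerivAt (fun y => ∫ r in (0 : ℝ)..y, deriv f r) (deriv f y) y :=
    intervalIntegral.integral_hasDerivAt_right (hc.intervalIntegrable _ _)
      hc.stronglyMeasurable.stronglyMeasurableAtFilter hc.continuousAt
  have hC1 : ContDiff ℝ 1 fun y => ∫ r in (0 : ℝ)..y, deriv f r := by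
    refine contDiff_one_iff_deriv.2 ⟨fun y => (hint y).differentiableAt, ?_⟩
    rwa [funext fun y => (hint y).deriv]
  have hac : AbsolutelyContinuousOnInterval
      (fun y => f y - ∫ r in (0 : ℝ)..y, deriv f r) (x - 1) (x + 1) :=
    hf.lipschitzOnWith.absolutelyContinuousOnInterval.sub
      hC1.contDiffOn.absolutelyContinuousOnInterval
  obtain ⟨C, hC⟩ := hac.const_of_ae_hasDerivAt_zero (by
    filter_upwards [hf.ae_differentiableAt_real] with y hy _
    simpa using hy.hasDerivAt.fun_sub (hint y))
  refine ((hint x).add_const C).congr_of_eventuallyEq ?_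
  filter_upwards [Icc_mem_nhds (sub_one_lt x) (lt_add_one x)] with y hy
  rw [← hC y (by rwa [uIcc_of_le (by linarith)]), add_sub_cancel]

theorem mul_sub_le_of_ae_le_deriv {f : ℝ → ℝ} {a b κ : ℝ} (hab : a ≤ b)
    (hf : AbsolutelyContinuousOnInterval f a b) (hκ : ∀ᵐ x, x ∈ Icc a b → κ ≤ deriv f x) :
    κ * (b - a) ≤ f b - f a := by
  rw [← hf.integral_deriv_eq_sub]
  have := intervalIntegral.integral_mono_ae_restrict (μ := volume) hab
    (intervalIntegrable_const (c := κ)) hf.intervalIntegrable_deriv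
    ((ae_restrict_iff' measurableSet_Icc).2 hκ)
  simpa [mul_comm] using this

theorem ae_norm_le_of_eLpNorm_top_le {α F : Type*} [NormedAddCommGroup F] {_ : MeasurableSpace α}
    {μ : Measure α} {f : α → F} {C : ℝ} (hC : 0 ≤ C) (h : eLpNorm f ∞ μ ≤ ENNReal.ofReal C) :
    ∀ᵐ x ∂μ, ‖f x‖ ≤ C := by
  rw [eLpNorm_exponent_top] at h
  filter_upwards [ae_le_eLpNormEssSup (f := f) (μ := μ)] with x hx
  rw [← ENNReal.ofReal_le_ofReal_iff hC, ofReal_norm]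
  exact hx.trans h

theorem forall_of_ae_of_isClosed {α : Type*} [TopologicalSpace α] {_ : MeasurableSpace α}
    {μ : Measure α} [μ.IsOpenPosMeasure] {p : α → Prop} (hp : IsClosed {x | p x})
    (h : ∀ᵐ x ∂μ, p x) (x : α) : p x :=
  eq_univ_iff_forall.1 (hp.ae_eq_univ_iff_eq.1 (eventuallyEq_univ.2 h)) x

theorem periodic_deriv {f : ℝ → E} {c : ℝ} (hf : Function.Periodic f c) :
    Function.Periodic (deriv f) c := fun x => by
  rw [← deriv_comp_add_const, hf.funext]

theorem exists_norm_le_of_periodic {F : Type*} [NormedAddCommGroup F] {f : ℝ → F} {c : ℝ}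
    (hf : Function.Periodic f c) (hc : c ≠ 0) (hcont : Continuous f) : ∃ C, ∀ x, ‖f x‖ ≤ C := by
  obtain ⟨C, hC⟩ := (hf.isBounded_of_continuous hc hcont).exists_norm_le
  exact ⟨C, fun x => hC _ (mem_range_self x)⟩

theorem inner_deriv_eq_zero_of_norm_eq_one {V : Type*} [NormedAddCommGroup V]
    [InnerProductSpace ℝ V] {f : ℝ → V} {f' : V} {x : ℝ} (hf : HasDerivAt f f' x)
    (hnorm : ∀ᶠ y in 𝓝 x, ‖f y‖ = 1) : inner ℝ (f x) f' = (0 : ℝ) := by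
  have hconst : HasDerivAt (fun y => ‖f y‖ ^ 2) 0 x :=
    (hasDerivAt_const x (1 : ℝ)).congr_of_eventuallyEq (hnorm.mono fun y hy => by simp [hy])
  linarith [hf.norm_sq.unique hconst]

theorem hasDerivAt_norm_of_ne_zero {V : Type*} [NormedAddCommGroup V] [InnerProductSpace ℝ V]
    {f : ℝ → V} {f' : V} {x : ℝ} (hf : HasDerivAt f f' x) (hx : f x ≠ 0) :
    HasDerivAt (fun y => ‖f y‖) (inner ℝ (f x) f' / ‖f x‖) x := by
  have hsqrt := hf.norm_sq.sqrt (pow_ne_zero 2 (norm_ne_zero_iff.2 hx))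
  simp only [Real.sqrt_sq (norm_nonneg _)] at hsqrt
  exact hsqrt.congr_deriv (mul_div_mul_left _ _ two_ne_zero)

theorem lipschitzWith_inner {α V : Type*} [PseudoMetricSpace α] [NormedAddCommGroup V]
    [InnerProductSpace ℝ V] {f h : α → V} {A B K L : NNReal} (hf : LipschitzWith K f)
    (hh : LipschitzWith L h) (hfA : ∀ x, ‖f x‖ ≤ A) (hhB : ∀ x, ‖h x‖ ≤ B) :
    LipschitzWith (K * B + A * L) fun x => (inner ℝ (f x) (h x) : ℝ) := by
  refine LipschitzWith.of_dist_le_mul fun x y => ?_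
  have hsplit : (inner ℝ (f x) (h x) : ℝ) - inner ℝ (f y) (h y)
      = inner ℝ (f x - f y) (h x) + inner ℝ (f y) (h x - h y) := by
    rw [inner_sub_left, inner_sub_right, sub_add_sub_cancel]
  calc dist (inner ℝ (f x) (h x) : ℝ) (inner ℝ (f y) (h y))
      ≤ ‖f x - f y‖ * ‖h x‖ + ‖f y‖ * ‖h x - h y‖ := by
        rw [dist_eq_norm, hsplit]
        exact (norm_add_le _ _).trans
          (add_le_add (norm_inner_le_norm _ _) (norm_inner_le_norm _ _))
    _ ≤ K * dist x y * B + A * (L * dist x y) := by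
        rw [← dist_eq_norm, ← dist_eq_norm]
        gcongr
        exacts [hf.dist_le_mul x y, hhB x, hfA y, hh.dist_le_mul x y]
    _ = ↑(K * B + A * L) * dist x y := by push_cast; ring

theorem tendsto_inv_sub_nhdsLT (S : ℝ) : Tendsto (fun r => (S - r)⁻¹) (𝓝[<] S) atTop := by
  refine tendsto_inv_nhdsGT_zero.comp (tendsto_nhdsWithin_iff.2 ⟨?_, ?_⟩)
  · have : ContinuousAt (fun r => S - r) S := by fun_prop
    simpa using this.tendsto.mono_left nhdsWithin_le_nhds
  · filter_upwards [self_mem_nhdsWithin] with r hr using sub_pos.2 (mem_Iio.1 hr)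

theorem norm_le_gronwallBound_of_mem_Ico {f f' : ℝ → E} {a b δ K ε : ℝ} (hK : 0 ≤ K) (hε : 0 ≤ ε)
    (hf : ContinuousOn f (Ico a b)) (hf' : ∀ x ∈ Ioo a b, HasDerivAt f (f' x) x)
    (ha : ‖f a‖ < δ) (bound : ∀ x ∈ Ioo a b, ‖f' x‖ ≤ K * ‖f x‖ + ε) {x : ℝ}
    (hx : x ∈ Ico a b) : ‖f x‖ ≤ gronwallBound δ K ε (b - a) := by
  have hmono : Monotone (gronwallBound δ K ε) :=
    gronwallBound_mono ((norm_nonneg _).trans ha.le) hε hK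
  obtain rfl | hax := hx.1.eq_or_lt
  · calc ‖f a‖ ≤ gronwallBound δ K ε 0 := by rw [gronwallBound_x0]; exact ha.le
      _ ≤ gronwallBound δ K ε (b - a) := hmono (sub_nonneg.2 hx.2.le)
  have hnear : ∀ᶠ a' in 𝓝[>] a, ‖f a'‖ < δ :=
    nhdsWithin_le_of_mem (mem_of_superset (Ioo_mem_nhdsGT (hax.trans hx.2)) Ioo_subset_Ico_self)
      ((hf a ⟨le_rfl, hax.trans hx.2⟩).norm.eventually (gt_mem_nhds ha))
  obtain ⟨a', ha', haa', ha'x⟩ := (hnear.and (Ioo_mem_nhdsGT hax)).exists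
  have hsub : ∀ y ∈ Icc a' x, y ∈ Ioo a b := fun y hy =>
    ⟨haa'.trans_le hy.1, hy.2.trans_lt hx.2⟩
  have hle := norm_le_gronwallBound_of_norm_deriv_right_le
    (hf.mono fun y hy => Ioo_subset_Ico_self (hsub y hy))
    (fun y hy => (hf' y (hsub y (Ico_subset_Icc_self hy))).hasDerivWithinAt) ha'.le
    (fun y hy => bound y (hsub y (Ico_subset_Icc_self hy))) x (right_mem_Icc.2 ha'x.le)
  exact hle.trans (hmono (by linarith [hx.2]))

end RealAnalysis

section MixedPartials

variable {E : Type*} [NormedAddCommGroup E] [NormedSpace ℝ E]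

theorem norm_slope_sub_le_of_hasDerivAt {g g' : ℝ → E} {v : E} {C : ℝ} {S : Set ℝ}
    (hS : Convex ℝ S) (hg : ∀ x ∈ S, HasDerivAt g (g' x) x) (hC : ∀ x ∈ S, ‖g' x - v‖ ≤ C)
    {x y : ℝ} (hx : x ∈ S) (hy : y ∈ S) (hxy : y ≠ x) : ‖slope g x y - v‖ ≤ C := by
  have hmean := hS.norm_image_sub_le_of_norm_hasDerivWithin_le (f := fun x => g x - x • v)
    (fun x hx => ((hg x hx).fun_sub ((hasDerivAt_id x).smul_const v)).hasDerivWithinAt)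
    (fun x hx => by simpa using hC x hx) hx hy
  have hslope : slope g x y - v = (y - x)⁻¹ • (g y - y • v - (g x - x • v)) := by
    rw [slope_def_module, show g y - y • v - (g x - x • v) = g y - g x - (y - x) • v by module,
      smul_sub _ _ ((y - x) • v), inv_smul_smul₀ (sub_ne_zero.2 hxy)]
  rw [hslope, norm_smul, norm_inv, inv_mul_le_iff₀ (norm_pos_iff.2 (sub_ne_zero.2 hxy)), mul_comm]
  exact hmean

theorem eventually_nhdsNE_prod_nhds {X Y : Type*} [TopologicalSpace X] [TopologicalSpace Y]
    {P : X × Y → Prop} {t : X} {s : Y} (hP : ∀ᶠ q in 𝓝 (t, s), P q) :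
    ∀ᶠ n : Y × X in 𝓝[≠] s ×ˢ 𝓝 t, n.1 ≠ s ∧ P (n.2, n.1) ∧ P (n.2, s) := by
  have hle : 𝓝[≠] s ×ˢ 𝓝 t ≤ 𝓝 (s, t) :=
    (Filter.prod_mono nhdsWithin_le_nhds le_rfl).trans_eq nhds_prod_eq.symm
  have hswap : Tendsto (fun n : Y × X => (n.2, n.1)) (𝓝 (s, t)) (𝓝 (t, s)) :=
    continuous_swap.tendsto (s, t)
  have hfix : Tendsto (fun n : Y × X => (n.2, s)) (𝓝 (s, t)) (𝓝 (t, s)) :=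
    (by fun_prop : Continuous fun n : Y × X => (n.2, s)).tendsto (s, t)
  have hne : ∀ᶠ n : Y × X in 𝓝[≠] s ×ˢ 𝓝 t, n.1 ≠ s := tendsto_fst.eventually self_mem_nhdsWithin
  exact hne.and (((hswap.eventually hP).filter_mono hle).and ((hfix.eventually hP).filter_mono hle))

-- Only `∂ₛ ∂ₜ f` is assumed to exist near `(t, s)`; `p` is `∂ₛ f` on the line through `s`.
theorem hasDerivAt_partial_of_continuousAt {f g k : ℝ → ℝ → E} {p : ℝ → E} {t s : ℝ}
    (hg : ∀ᶠ q : ℝ × ℝ in 𝓝 (t, s), HasDerivAt (fun r => f r q.2) (g q.1 q.2) q.1)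
    (hk : ∀ᶠ q : ℝ × ℝ in 𝓝 (t, s), HasDerivAt (g q.1) (k q.1 q.2) q.2)
    (hp : ∀ᶠ r in 𝓝 t, HasDerivAt (f r) (p r) s)
    (hcont : ContinuousAt (fun q : ℝ × ℝ => k q.1 q.2) (t, s)) :
    HasDerivAt p (k t s) t := by
  refine hasDerivAt_of_tendstoUniformlyOnFilter (l := 𝓝[≠] s) (f := fun σ r => slope (f r) s σ)
    (f' := fun σ r => slope (g r) s σ) (g' := fun _ => k t s) ?_ ?_ ?_
  · rw [Metric.tendstoUniformlyOnFilter_iff]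
    intro ε hε
    have hclose : ∀ᶠ q : ℝ × ℝ in 𝓝 (t, s), ‖k q.1 q.2 - k t s‖ ≤ ε / 2 := by
      filter_upwards [hcont.eventually (Metric.closedBall_mem_nhds _ (half_pos hε))] with q hq
      rwa [← dist_eq_norm]
    obtain ⟨δ, hδ, hball⟩ := Metric.eventually_nhds_iff_ball.1 (hk.and hclose)
    simp only [← ball_prod_same, Prod.forall, mem_prod] at hball
    have hmem : ∀ᶠ q : ℝ × ℝ in 𝓝 (t, s), q ∈ Metric.ball t δ ×ˢ Metric.ball s δ :=
      prod_mem_nhds (Metric.ball_mem_nhds t hδ) (Metric.ball_mem_nhds s hδ)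
    filter_upwards [eventually_nhdsNE_prod_nhds hmem] with n ⟨hne, hn, hns⟩
    rw [dist_comm, dist_eq_norm]
    exact (norm_slope_sub_le_of_hasDerivAt (convex_ball s δ)
      (fun σ hσ => (hball n.2 σ ⟨hn.1, hσ⟩).1) (fun σ hσ => (hball n.2 σ ⟨hn.1, hσ⟩).2)
      hns.2 hn.2 hne).trans_lt (half_lt_self hε)
  · filter_upwards [eventually_nhdsNE_prod_nhds hg] with n ⟨_, hn, hns⟩
    exact (hn.fun_sub hns).const_smul _
  · filter_upwards [hp] with r hr using hasDerivAt_iff_tendsto_slope.1 hr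

-- A one-sided substitute for `∂ₜ ∂ₛ f = ∂ₛ ∂ₜ f` when `∂ₜ f` is merely Lipschitz in `s`.
theorem mul_sub_le_partial_sub {f g : ℝ → ℝ → ℝ} {p : ℝ → ℝ} {t r s κ δ : ℝ} (hδ : 0 < δ)
    (htr : t ≤ r)
    (hg : ∀ ρ ∈ Icc t r, ∀ σ, HasDerivAt (fun ρ => f ρ σ) (g ρ σ) ρ)
    (hκ : ∀ ρ ∈ Icc t r, ∀ h ∈ Ioo 0 δ, κ * h ≤ g ρ (s + h) - g ρ s)
    (hp : ∀ ρ ∈ Icc t r, HasDerivAt (f ρ) (p ρ) s) :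
    κ * (r - t) ≤ p r - p t := by
  have htime : ∀ h ∈ Ioo 0 δ,
      κ * h * (r - t) ≤ (f r (s + h) - f r s) - (f t (s + h) - f t s) := fun h hh => by
    have hd : ∀ ρ ∈ Icc t r,
        HasDerivAt (fun ρ => f ρ (s + h) - f ρ s) (g ρ (s + h) - g ρ s) ρ :=
      fun ρ hρ => (hg ρ hρ (s + h)).fun_sub (hg ρ hρ s)
    refine (convex_Icc t r).mul_sub_le_image_sub_of_le_deriv
      (fun ρ hρ => (hd ρ hρ).continuousAt.continuousWithinAt)
      (fun ρ hρ => (hd ρ (interior_subset hρ)).differentiableAt.differentiableWithinAt)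
      (fun ρ hρ => ?_) t (left_mem_Icc.2 htr) r (right_mem_Icc.2 htr) htr
    rw [(hd ρ (interior_subset hρ)).deriv]
    exact hκ ρ (interior_subset hρ) h hh
  have hlim : Tendsto (fun h => h⁻¹ • (f r (s + h) - f r s) - h⁻¹ • (f t (s + h) - f t s))
      (𝓝[>] 0) (𝓝 (p r - p t)) :=
    (hp r (right_mem_Icc.2 htr)).tendsto_slope_zero_right.sub
      (hp t (left_mem_Icc.2 htr)).tendsto_slope_zero_right
  refine ge_of_tendsto hlim ?_
  filter_upwards [Ioo_mem_nhdsGT hδ] with h hh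
  rw [← smul_sub, smul_eq_mul, le_inv_mul_iff₀ hh.1]
  linarith [htime h hh]

end MixedPartials

section Riccati

/-- A supersolution on `(t₀, T)` of the Riccati equation `X' = X² - 2 a X + 2 |a| - c`. The equation
is multiplied by a positive solution `ℓ` of `ℓ' = ℓ (a - X)`, so that the derivative of `X` occurs
only in `(ℓ X)'`, and is then required of the lower right difference quotients of `ℓ X`. -/
structure IsRiccatiSupersolution (t₀ T c : ℝ) (ℓ a X : ℝ → ℝ) : Prop where
  continuousOn : ContinuousOn X (Ico t₀ T)
  hasDerivAt : ∀ t ∈ Ioo t₀ T, HasDerivAt ℓ (ℓ t * (a t - X t)) t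
  pos : ∀ t ∈ Ioo t₀ T, 0 < ℓ t
  two_mul_abs_le : ∀ t ∈ Ioo t₀ T, 2 * |a t| ≤ c
  slope : ∀ t ∈ Ioo t₀ T, ∀ κ < ℓ t * (2 * |a t| - c - a t * X t),
    ∀ᶠ r in 𝓝[>] t, κ * (r - t) ≤ ℓ r * X r - ℓ t * X t

namespace IsRiccatiSupersolution

variable {t₀ T c : ℝ} {ℓ a X : ℝ → ℝ}

theorem continuousAt (h : IsRiccatiSupersolution t₀ T c ℓ a X) {t : ℝ} (ht : t ∈ Ioo t₀ T) :
    ContinuousAt X t :=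
  h.continuousOn.continuousAt (Ico_mem_nhds ht.1 ht.2)

theorem lt_of_hasDerivAt_barrier (h : IsRiccatiSupersolution t₀ T c ℓ a X) {t y y' : ℝ}
    (ht : t ∈ Ioo t₀ T) (hy' : y' < y ^ 2 - c * |y|) (hone : 1 ≤ |y|) :
    ℓ t * (a t - y) * y + ℓ t * y' < ℓ t * (2 * |a t| - c - a t * y) := by
  have hprod : 0 ≤ (c - 2 * |a t|) * (|y| - 1) :=
    mul_nonneg (sub_nonneg.2 (h.two_mul_abs_le t ht)) (sub_nonneg.2 hone)
  have habs : a t * y ≤ |a t| * |y| := by rw [← abs_mul]; exact le_abs_self _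
  have hrate : (a t - y) * y + y' < 2 * |a t| - c - a t * y := by nlinarith
  nlinarith [mul_lt_mul_of_pos_left hrate (h.pos t ht)]

theorem barrier_le (h : IsRiccatiSupersolution t₀ T c ℓ a X) {y y' : ℝ → ℝ} {t₁ t₂ : ℝ}
    (hsub : Icc t₁ t₂ ⊆ Ioo t₀ T) (hy : ∀ t ∈ Icc t₁ t₂, HasDerivAt y (y' t) t)
    (hy' : ∀ t ∈ Icc t₁ t₂, y' t < y t ^ 2 - c * |y t|) (hone : ∀ t ∈ Icc t₁ t₂, 1 ≤ |y t|)
    (hinit : y t₁ ≤ X t₁) {t : ℝ} (ht : t ∈ Icc t₁ t₂) : y t ≤ X t := by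
  have ht₁ : t₁ ∈ Ioo t₀ T := hsub (left_mem_Icc.2 (ht.1.trans ht.2))
  have hbarrier : ∀ t ∈ Icc t₁ t₂, HasDerivAt (fun t => -(ℓ t * y t))
      (-(ℓ t * (a t - X t) * y t + ℓ t * y' t)) t := fun t ht =>
    ((h.hasDerivAt t (hsub ht)).mul (hy t ht)).neg
  have hcont : ContinuousOn (fun t => -(ℓ t * X t)) (Icc t₁ t₂) := fun t ht =>
    ((h.hasDerivAt t (hsub ht)).continuousAt.mul (h.continuousAt (hsub ht))).neg.continuousWithinAt
  suffices -(ℓ t * X t) ≤ -(ℓ t * y t) from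
    le_of_mul_le_mul_left (neg_le_neg_iff.1 this) (h.pos t (hsub ht))
  refine image_le_of_liminf_slope_right_lt_deriv_boundary'
    (f := fun t => -(ℓ t * X t)) (f' := fun t => -(ℓ t * (2 * |a t| - c - a t * X t)))
    (B := fun t => -(ℓ t * y t)) hcont (fun t ht r hr => Eventually.frequently ?_)
    (neg_le_neg (mul_le_mul_of_nonneg_left hinit (h.pos t₁ ht₁).le))
    (fun t ht => (hbarrier t ht).continuousAt.continuousWithinAt)
    (fun t ht => (hbarrier t (Ico_subset_Icc_self ht)).hasDerivWithinAt)
    (fun t ht heq => ?_) ht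
  · obtain ⟨κ, hκ, hκr⟩ := exists_between hr
    filter_upwards [h.slope t (hsub (Ico_subset_Icc_self ht)) (-κ) (by linarith),
      self_mem_nhdsWithin] with r' hr' htr'
    have htr' : 0 < r' - t := sub_pos.2 htr'
    rw [slope_def_field, div_lt_iff₀ htr']
    nlinarith
  · have ht := Ico_subset_Icc_self ht
    have hXy : X t = y t := mul_left_cancel₀ (h.pos t (hsub ht)).ne' (neg_injective heq)
    rw [hXy, neg_lt_neg_iff]
    exact h.lt_of_hasDerivAt_barrier (hsub ht) (hy' t ht) (hone t ht)

theorem nonneg (h : IsRiccatiSupersolution t₀ T c ℓ a X) {t : ℝ} (ht : t ∈ Ioo t₀ T) : 0 ≤ c :=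
  (by positivity : 0 ≤ 2 * |a t|).trans (h.two_mul_abs_le t ht)

theorem neg_le (h : IsRiccatiSupersolution t₀ T c ℓ a X) {C : ℝ} (hC : c + 1 ≤ C)
    (hinit : -C < X t₀) {t : ℝ} (ht : t ∈ Ioo t₀ T) : -C ≤ X t := by
  have hc := h.nonneg ht
  have hnear : ∀ᶠ t₁ in 𝓝[>] t₀, -C < X t₁ :=
    nhdsWithin_le_of_mem (mem_of_superset (Ioo_mem_nhdsGT (ht.1.trans ht.2)) Ioo_subset_Ico_self)
      ((h.continuousOn t₀ ⟨le_rfl, ht.1.trans ht.2⟩).eventually (lt_mem_nhds hinit))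
  obtain ⟨t₁, hinit₁, ht₁, ht₁t⟩ := (hnear.and (Ioo_mem_nhdsGT ht.1)).exists
  have habs : |-C| = C := by rw [abs_neg, abs_of_nonneg (by linarith)]
  exact h.barrier_le (y := fun _ => -C) (Icc_subset_Ioo ht₁ ht.2)
    (fun r _ => hasDerivAt_const r (-C)) (fun r _ => by rw [habs]; nlinarith)
    (fun r _ => by rw [habs]; linarith) hinit₁.le (right_mem_Icc.2 ht₁t.le)

theorem inv_add_le (h : IsRiccatiSupersolution t₀ T c ℓ a X) {S t r : ℝ} (hS : S < T)
    (ht : t₀ < t) (htr : t ≤ r) (hrS : r < S) (hinit : (S - t)⁻¹ + (c + 1) ≤ X t) :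
    (S - r)⁻¹ + (c + 1) ≤ X r := by
  have hc := h.nonneg ⟨ht, htr.trans_lt (hrS.trans hS)⟩
  have hpos : ∀ σ ∈ Icc t r, 0 < S - σ := fun σ hσ => sub_pos.2 (hσ.2.trans_lt hrS)
  have habs : ∀ σ ∈ Icc t r, |(S - σ)⁻¹ + (c + 1)| = (S - σ)⁻¹ + (c + 1) := fun σ hσ => by
    have := inv_pos.2 (hpos σ hσ)
    exact abs_of_nonneg (by linarith)
  refine h.barrier_le (y := fun σ => (S - σ)⁻¹ + (c + 1)) (y' := fun σ => ((S - σ)⁻¹) ^ 2)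
    (Icc_subset_Ioo ht (hrS.trans hS)) (fun σ hσ => ?_) (fun σ hσ => ?_) (fun σ hσ => ?_) hinit
    (right_mem_Icc.2 htr)
  · refine ((((hasDerivAt_id σ).const_sub S).fun_inv (hpos σ hσ).ne').add_const _).congr_deriv ?_
    simp [inv_pow]
  · rw [habs σ hσ]
    nlinarith [inv_pos.2 (hpos σ hσ)]
  · rw [habs σ hσ]
    linarith [inv_pos.2 (hpos σ hσ)]

theorem le_inv_add (h : IsRiccatiSupersolution t₀ T c ℓ a X) {t : ℝ} (ht : t ∈ Ioo t₀ T) :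
    X t ≤ (T - t)⁻¹ + (c + 1) := by
  by_contra! hlt
  have hcont : ContinuousAt (fun S => (S - t)⁻¹ + (c + 1)) T := by
    fun_prop (disch := exact (sub_pos.2 ht.2).ne')
  have hearlier : ∀ᶠ S in 𝓝[<] T, (S - t)⁻¹ + (c + 1) < X t :=
    nhdsWithin_le_nhds (hcont.eventually (gt_mem_nhds hlt))
  obtain ⟨S, hinit, htS, hST⟩ := (hearlier.and (Ioo_mem_nhdsLT ht.2)).exists
  have hblowup : Tendsto X (𝓝[<] S) atTop := by
    refine tendsto_atTop_mono' _ ?_ ((tendsto_inv_sub_nhdsLT S).atTop_add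
      (tendsto_const_nhds (x := c + 1)))
    filter_upwards [Ioo_mem_nhdsLT htS] with r hr
    exact h.inv_add_le hST ht.1 hr.1.le hr.2 hinit.le
  exact not_tendsto_nhds_of_tendsto_atTop hblowup _
    ((h.continuousAt ⟨ht.1.trans htS, hST⟩).tendsto.mono_left nhdsWithin_le_nhds)

end IsRiccatiSupersolution

end Riccati

section PlaneFrame

theorem norm_perp (x : Plane) : ‖perp x‖ = ‖x‖ := by
  simp [perp, EuclideanSpace.norm_eq, Fin.sum_univ_two, add_comm]

theorem eq_inner_smul_add_inner_perp_smul {e : Plane} (he : ‖e‖ = 1) (x : Plane) :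
    x = (inner ℝ x e : ℝ) • e + (inner ℝ x (perp e) : ℝ) • perp e := by
  have hsq : e 0 ^ 2 + e 1 ^ 2 = 1 := by
    rw [← Fin.sum_univ_two fun i => e i ^ 2, ← EuclideanSpace.real_norm_sq_eq, he, one_pow]
  ext i
  fin_cases i
  · simp [perp, PiLp.inner_apply, Fin.sum_univ_two]
    linear_combination -(x 0) * hsq
  · simp [perp, PiLp.inner_apply, Fin.sum_univ_two]
    linear_combination -(x 1) * hsq

theorem IsOutwardUnitNormal.mem_closure {Ω : Set Plane} {x ν : Plane}
    (h : IsOutwardUnitNormal Ω x ν) : x ∈ closure Ω := by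
  have hinside : ∀ᶠ r : ℝ in 𝓝[>] 0, x + r • -ν ∈ Ω :=
    h.2.1 (-ν) (by rw [inner_neg_left, real_inner_self_eq_norm_sq, h.1]; norm_num)
  have hlim : Tendsto (fun r : ℝ => x + r • -ν) (𝓝[>] 0) (𝓝 x) := by
    have hcont : Continuous fun r : ℝ => x + r • -ν := by fun_prop
    simpa using (hcont.tendsto 0).mono_left nhdsWithin_le_nhds
  exact mem_closure_of_tendsto hlim hinside

end PlaneFrame

section TangentialDerivative

variable {E : Type*} [NormedAddCommGroup E] [NormedSpace ℝ E]
  {V : Type*} [NormedAddCommGroup V] [InnerProductSpace ℝ V]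
  {c : ℝ → Plane} {s : ℝ}

theorem deriv_eq_norm_smul_tanDeriv (f : ℝ → E) (hc : deriv c s ≠ 0) :
    deriv f s = ‖deriv c s‖ • tanDeriv c f s := by
  rw [tanDeriv, smul_inv_smul₀ (norm_ne_zero_iff.2 hc)]

theorem norm_unitTangent (hc : deriv c s ≠ 0) : ‖unitTangent c s‖ = 1 := by
  rw [unitTangent, tanDeriv, norm_smul, norm_inv, norm_norm,
    inv_mul_cancel₀ (norm_ne_zero_iff.2 hc)]

theorem tanDeriv_fun_sub {f h : ℝ → E} (hf : DifferentiableAt ℝ f s)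
    (hh : DifferentiableAt ℝ h s) :
    tanDeriv c (fun σ => f σ - h σ) s = tanDeriv c f s - tanDeriv c h s := by
  simp only [tanDeriv, deriv_fun_sub hf hh, smul_sub]

theorem tanDeriv_inner {f h : ℝ → V} (hf : DifferentiableAt ℝ f s)
    (hh : DifferentiableAt ℝ h s) :
    tanDeriv c (fun σ => (inner ℝ (f σ) (h σ) : ℝ)) s
      = inner ℝ (f s) (tanDeriv c h s) + inner ℝ (tanDeriv c f s) (h s) := by
  simp only [tanDeriv, (hf.hasDerivAt.inner ℝ hh.hasDerivAt).deriv, smul_eq_mul, mul_add,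
    real_inner_smul_left, real_inner_smul_right]

theorem inner_tanDeriv_unitTangent (hc : ∀ᶠ σ in 𝓝 s, deriv c σ ≠ 0)
    (hτ : DifferentiableAt ℝ (unitTangent c) s) :
    inner ℝ (unitTangent c s) (tanDeriv c (unitTangent c) s) = (0 : ℝ) := by
  rw [tanDeriv, real_inner_smul_right, inner_deriv_eq_zero_of_norm_eq_one hτ.hasDerivAt
    (hc.mono fun σ => norm_unitTangent), mul_zero]

theorem norm_tanDeriv_unitTangent (hc : ∀ᶠ σ in 𝓝 s, deriv c σ ≠ 0)
    (hτ : DifferentiableAt ℝ (unitTangent c) s) :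
    ‖tanDeriv c (unitTangent c) s‖ = |curvature c s| := by
  have hnorm := norm_unitTangent hc.self_of_nhds
  have hframe := eq_inner_smul_add_inner_perp_smul hnorm (tanDeriv c (unitTangent c) s)
  rw [real_inner_comm, inner_tanDeriv_unitTangent hc hτ, zero_smul, zero_add] at hframe
  rw [hframe, norm_smul, norm_perp, hnorm, mul_one, curvature, abs_neg, unitNormal,
    Real.norm_eq_abs]

theorem periodic_tanDeriv {f : ℝ → E} {l : ℝ} (hc : Function.Periodic c l)
    (hf : Function.Periodic f l) : Function.Periodic (tanDeriv c f) l := fun s => by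
  simp only [tanDeriv, periodic_deriv hc s, periodic_deriv hf s]

theorem ae_norm_iterate_tanDeriv_le {k i : ℕ} {f : ℝ → E} {C : ℝ} (hi : i ≤ k) (hC : 0 ≤ C)
    (h : wNorm k c f ≤ ENNReal.ofReal C) : ∀ᵐ s, ‖(tanDeriv c)^[i] f s‖ ≤ C := by
  refine ae_norm_le_of_eLpNorm_top_le hC (le_trans ?_ h)
  exact Finset.single_le_sum
    (f := fun i => eLpNorm ((tanDeriv c)^[i] f) ∞ volume)
    (fun _ _ => bot_le) (Finset.mem_range.2 (Nat.lt_succ_of_le hi))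

theorem MemW.norm_iterate_tanDeriv_le {k i : ℕ} {f : ℝ → E} {C : ℝ} (hf : MemW k c f) (hi : i < k)
    (hC : 0 ≤ C) (h : wNorm k c f ≤ ENNReal.ofReal C) (s : ℝ) :
    ‖(tanDeriv c)^[i] f s‖ ≤ C := by
  obtain ⟨K, hK⟩ := hf i hi
  exact forall_of_ae_of_isClosed (isClosed_le hK.continuous.norm continuous_const)
    (ae_norm_iterate_tanDeriv_le hi.le hC h) s

theorem MemW.tanDeriv {k : ℕ} {f : ℝ → E} (hf : MemW (k + 1) c f) : MemW k c (tanDeriv c f) :=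
  fun i hi => by
    simpa only [Function.iterate_succ_apply] using hf (i + 1) (Nat.succ_lt_succ hi)

theorem MemW.differentiable [FiniteDimensional ℝ E] {k : ℕ} {f : ℝ → E} (hf : MemW k c f)
    (hk : 2 ≤ k) (hc : Continuous (deriv c)) (hc0 : ∀ s, deriv c s ≠ 0) : Differentiable ℝ f := by
  obtain ⟨K, hK⟩ := hf 0 (by omega)
  obtain ⟨K', hK'⟩ := hf 1 hk
  have hcont : Continuous (deriv f) :=
    (hc.norm.smul hK'.continuous).congr fun s => (deriv_eq_norm_smul_tanDeriv f (hc0 s)).symm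
  exact fun s => (hasDerivAt_of_lipschitzWith_of_continuous_deriv hK hcont s).differentiableAt

end TangentialDerivative

namespace IsC1On

variable {X Y Z : Type*} [NormedAddCommGroup X] [NormedSpace ℝ X] [NormedAddCommGroup Y]
  [NormedSpace ℝ Y] [NormedAddCommGroup Z] [NormedSpace ℝ Z] {S : Set X}

theorem continuousOn {f : X → Y} (hf : IsC1On f S) : ContinuousOn f S := by
  obtain ⟨_, -, h⟩ := hf
  exact fun q hq => (h q hq).continuousWithinAt

theorem fst {S : Set (X × Y)} : IsC1On (Prod.fst : X × Y → X) S :=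
  ⟨fun _ => ContinuousLinearMap.fst ℝ X Y, continuousOn_const, fun _ _ => hasFDerivWithinAt_fst⟩

theorem prodMk {f : X → Y} {h : X → Z} (hf : IsC1On f S) (hh : IsC1On h S) :
    IsC1On (fun x => (f x, h x)) S := by
  obtain ⟨f', hf', hf⟩ := hf
  obtain ⟨h', hh', hh⟩ := hh
  exact ⟨fun x => (f' x).prod (h' x),
    (ContinuousLinearMap.prodₗᵢ ℝ).continuous.comp_continuousOn (hf'.prodMk hh'),
    fun q hq => (hf q hq).prodMk (hh q hq)⟩

theorem sub {f h : X → Y} (hf : IsC1On f S) (hh : IsC1On h S) : IsC1On (fun x => f x - h x) S := by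
  obtain ⟨f', hf', hf⟩ := hf
  obtain ⟨h', hh', hh⟩ := hh
  exact ⟨fun x => f' x - h' x, hf'.sub hh', fun q hq => (hf q hq).fun_sub (hh q hq)⟩

theorem comp {R : Set Y} {h : Y → Z} {f : X → Y} (hh : IsC1On h R) (hf : IsC1On f S)
    (hmaps : MapsTo f S R) : IsC1On (fun x => h (f x)) S := by
  have hfc := hf.continuousOn
  obtain ⟨f', hf', hf⟩ := hf
  obtain ⟨h', hh', hh⟩ := hh
  exact ⟨fun x => (h' (f x)).comp (f' x), (hh'.comp hfc hmaps).clm_comp hf',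
    fun q hq => (hh (f q) (hmaps hq)).comp q (hf q hq) hmaps⟩

variable {I : Set X} {f : X → ℝ → Y}

theorem exists_hasDerivAt_slice (hf : IsC1On (Function.uncurry f) (I ×ˢ univ)) :
    ∃ k : X × ℝ → Y, ContinuousOn k (I ×ˢ univ) ∧
      ∀ t ∈ I, ∀ s, HasDerivAt (f t) (k (t, s)) s := by
  obtain ⟨f', hf', hf⟩ := hf
  refine ⟨fun q => f' q (0, 1), hf'.clm_apply continuousOn_const, fun t ht s => ?_⟩
  exact (hf (t, s) ⟨ht, mem_univ s⟩).comp_hasDerivAt s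
    ((hasDerivAt_const s t).prodMk (hasDerivAt_id s))
    (Eventually.of_forall fun σ => ⟨ht, mem_univ σ⟩)

theorem differentiable_slice (hf : IsC1On (Function.uncurry f) (I ×ˢ univ)) {t : X} (ht : t ∈ I) :
    Differentiable ℝ (f t) := by
  obtain ⟨k, -, hk⟩ := hf.exists_hasDerivAt_slice
  exact fun s => (hk t ht s).differentiableAt

theorem continuousOn_deriv_slice (hf : IsC1On (Function.uncurry f) (I ×ˢ univ)) :
    ContinuousOn (Function.uncurry fun t => deriv (f t)) (I ×ˢ univ) := by
  obtain ⟨k, hkc, hk⟩ := hf.exists_hasDerivAt_slice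
  exact hkc.congr fun q hq => (hk q.1 hq.1 q.2).deriv

end IsC1On

section EulerPhase

theorem tanDeriv_comp {E : Type*} [NormedAddCommGroup E] [NormedSpace ℝ E] {c : ℝ → Plane} {s : ℝ}
    {f : Plane → E} {f' : Plane →L[ℝ] E} {S : Set Plane} (hf : HasFDerivWithinAt f f' S (c s))
    (hc : DifferentiableAt ℝ c s) (hmem : ∀ σ, c σ ∈ S) :
    tanDeriv c (fun σ => f (c σ)) s = f' (unitTangent c s) := by
  have hcomp : HasDerivAt (fun σ => f (c σ)) (f' (deriv c s)) s :=
    hf.comp_hasDerivAt s hc.hasDerivAt (Eventually.of_forall hmem)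
  rw [tanDeriv, hcomp.deriv, unitTangent, tanDeriv, map_smul]

theorem MomentumAt.inner_add_eq {g : ℝ} {u : ℝ → Plane → Plane} {p : ℝ → Plane → ℝ} {t : ℝ}
    {x : Plane} {u' : ℝ × Plane →L[ℝ] Plane} {p' : Plane →L[ℝ] ℝ} (h : MomentumAt g u p t x)
    (hu : HasFDerivAt (Function.uncurry u) u' (t, x)) (hp : HasFDerivAt (p t) p' x) (v : Plane) :
    inner ℝ (u' (1, u t x)) v + p' v = inner ℝ (-(g • e₂)) v := by
  have htime : deriv (fun r => u r x) t = u' (1, 0) :=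
    (HasFDerivAt.comp_hasDerivAt t (f := fun r => (r, x)) hu
      ((hasDerivAt_id t).prodMk (hasDerivAt_const t x))).deriv
  have hspace : fderiv ℝ (u t) x = u'.comp (ContinuousLinearMap.inr ℝ ℝ Plane) :=
    (hu.comp x (hasFDerivAt_prodMk_right t x)).fderiv
  have hgrad : inner ℝ (gradient (p t) x) v = p' v := by
    rw [gradient, hp.fderiv, InnerProductSpace.toDual_symm_apply]
  rw [← h, htime, hspace, inner_add_left, hgrad, ContinuousLinearMap.comp_apply,
    ContinuousLinearMap.inr_apply, ← map_add, Prod.mk_add_mk, add_zero, zero_add]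

/-- One of the two fluids: velocity and pressure, `C¹` up to the boundary of the moving region
`Ω t`, solve the momentum equation there. It is stated for a single fluid because the argument at
the interface is the same on both sides. -/
structure IsEulerPhase (T g : ℝ) (Ω : ℝ → Set Plane) (u : ℝ → Plane → Plane)
    (p : ℝ → Plane → ℝ) : Prop where
  isOpen_spaceTime : IsOpen (spaceTime T Ω)
  velocity : IsC1On (Function.uncurry u) (closedSpaceTime T Ω)
  pressure : ∀ t ∈ Ioo 0 T, IsC1On (p t) (closure (Ω t))
  momentum : ∀ t ∈ Ioo 0 T, ∀ x ∈ Ω t, MomentumAt g u p t x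

namespace IsEulerPhase

variable {T g : ℝ} {Ω : ℝ → Set Plane} {u : ℝ → Plane → Plane} {p : ℝ → Plane → ℝ}

theorem isOpen_slice (h : IsEulerPhase T g Ω u p) {t : ℝ} (ht : t ∈ Ioo 0 T) : IsOpen (Ω t) := by
  have hslice : Ω t = (fun x => (t, x)) ⁻¹' spaceTime T Ω := by ext x; simp [spaceTime, ht.1, ht.2]
  rw [hslice]
  exact h.isOpen_spaceTime.preimage (by fun_prop)

-- The equation holds in the open region and both sides are continuous on its closure.
theorem inner_add_eq_of_mem_closure (h : IsEulerPhase T g Ω u p)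
    {u' : ℝ × Plane → (ℝ × Plane →L[ℝ] Plane)} {t : ℝ} {p' : Plane → (Plane →L[ℝ] ℝ)}
    (hu' : ContinuousOn u' (closedSpaceTime T Ω))
    (hu : ∀ q ∈ closedSpaceTime T Ω,
      HasFDerivWithinAt (Function.uncurry u) (u' q) (closedSpaceTime T Ω) q)
    (ht : t ∈ Ioo 0 T) (hp' : ContinuousOn p' (closure (Ω t)))
    (hp : ∀ x ∈ closure (Ω t), HasFDerivWithinAt (p t) (p' x) (closure (Ω t)) x)
    {x : Plane} (hx : x ∈ closure (Ω t)) (v : Plane) :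
    inner ℝ (u' (t, x) (1, u t x)) v + p' x v = inner ℝ (-(g • e₂)) v := by
  have hmaps : MapsTo (fun x => (t, x)) (closure (Ω t)) (closedSpaceTime T Ω) :=
    fun x hx => ⟨Ioo_subset_Ico_self ht, hx⟩
  have hpair : ContinuousOn (fun x : Plane => (t, x)) (closure (Ω t)) := by fun_prop
  have hcont : ContinuousOn (fun x => inner ℝ (u' (t, x) (1, u t x)) v + p' x v)
      (closure (Ω t)) := by
    refine (ContinuousOn.inner (𝕜 := ℝ) ?_ continuousOn_const).add
      (hp'.clm_apply continuousOn_const)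
    exact (hu'.comp hpair hmaps).clm_apply
      (continuousOn_const.prodMk (h.velocity.continuousOn.comp hpair hmaps))
  refine EqOn.of_subset_closure (s := Ω t) (fun x hx => ?_) hcont continuousOn_const
    subset_closure subset_rfl hx
  have hnhds : closedSpaceTime T Ω ∈ 𝓝 (t, x) :=
    mem_of_superset (h.isOpen_spaceTime.mem_nhds ⟨ht, hx⟩)
      fun q hq => ⟨Ioo_subset_Ico_self hq.1, subset_closure hq.2⟩
  exact (h.momentum t ht x hx).inner_add_eq
    ((hu _ (hmaps (subset_closure hx))).hasFDerivAt hnhds)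
    ((hp x (subset_closure hx)).hasFDerivAt
      (mem_of_superset ((h.isOpen_slice ht).mem_nhds hx) subset_closure)) v

variable {z : ℝ → ℝ → Plane} {t s : ℝ}

theorem differentiableAt_pressure_trace (h : IsEulerPhase T g Ω u p) (ht : t ∈ Ioo 0 T)
    (hz : ∀ σ, z t σ ∈ closure (Ω t)) (hzs : DifferentiableAt ℝ (z t) s) :
    DifferentiableAt ℝ (fun σ => p t (z t σ)) s := by
  obtain ⟨p', -, hp⟩ := h.pressure t ht
  exact ((hp _ (hz s)).comp_hasDerivAt s hzs.hasDerivAt (Eventually.of_forall hz)).differentiableAt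

-- The tangential momentum balance for an observer slipping at speed `w` against the fluid.
theorem exists_hasDerivAt_velocity_trace (h : IsEulerPhase T g Ω u p) (ht : t ∈ Ioo 0 T)
    (hz : ∀ r ∈ Ico 0 T, ∀ σ, z r σ ∈ closure (Ω r)) (hzs : DifferentiableAt ℝ (z t) s) {w : ℝ}
    (hzt : HasDerivAt (fun r => z r s) (u t (z t s) - w • unitTangent (z t) s) t) :
    ∃ v' : Plane, HasDerivAt (fun r => u r (z r s)) v' t ∧
      inner ℝ v' (unitTangent (z t) s) = inner ℝ (-(g • e₂)) (unitTangent (z t) s)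
        - tanDeriv (z t) (fun σ => p t (z t σ)) s
        - w * inner ℝ (tanDeriv (z t) (fun σ => u t (z t σ)) s) (unitTangent (z t) s) := by
  have ht' := Ioo_subset_Ico_self ht
  obtain ⟨u', hu', hu⟩ := h.velocity
  obtain ⟨p', hp', hp⟩ := h.pressure t ht
  have hmoment :=
    h.inner_add_eq_of_mem_closure hu' hu ht hp' hp (hz t ht' s) (unitTangent (z t) s)
  have hut : HasFDerivWithinAt (u t) ((u' (t, z t s)).comp (ContinuousLinearMap.inr ℝ ℝ Plane))
      (closure (Ω t)) (z t s) :=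
    (hu (t, z t s) ⟨ht', hz t ht' s⟩).comp (z t s)
      (hasFDerivAt_prodMk_right t (z t s)).hasFDerivWithinAt fun x hx => ⟨ht', hx⟩
  have hrate : u' (t, z t s) (1, u t (z t s) - w • unitTangent (z t) s)
      = u' (t, z t s) (1, u t (z t s))
        - w • tanDeriv (z t) (fun σ => u t (z t σ)) s := by
    rw [tanDeriv_comp hut hzs (hz t ht'), ContinuousLinearMap.comp_apply,
      ContinuousLinearMap.inr_apply, ← map_smul, ← map_sub, Prod.smul_mk, smul_zero,
      Prod.mk_sub_mk, sub_zero]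
  have hvel : HasDerivAt (fun r => u r (z r s))
      (u' (t, z t s) (1, u t (z t s) - w • unitTangent (z t) s)) t :=
    HasFDerivWithinAt.comp_hasDerivAt t (f := fun r => (r, z r s))
      (hu (t, z t s) ⟨ht', hz t ht' s⟩) ((hasDerivAt_id t).prodMk hzt)
      (by filter_upwards [Ico_mem_nhds ht.1 ht.2] with r hr using ⟨hr, hz r hr s⟩)
  refine ⟨_, hvel, ?_⟩
  rw [hrate, inner_sub_left, real_inner_smul_left,
    tanDeriv_comp (hp _ (hz t ht' s)) hzs (hz t ht'), ← hmoment, add_sub_cancel_right]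

end IsEulerPhase

end EulerPhase

namespace Flow

/-- The tangential velocity jump `δu · T`. -/
noncomputable def slip (F : Flow) (t : ℝ) : ℝ → ℝ := fun s => inner ℝ (F.δv t s) (F.τ t s)

/-- The speed `|z_s|` of the Lagrangian parametrization of the interface. -/
noncomputable def speed (F : Flow) (t : ℝ) : ℝ → ℝ := fun s => ‖deriv (F.z t) s‖

/-- The rate of change of the tangential velocity jump along a particle path of `u⁻`, in the form
free of time derivatives and pressures to which the two momentum equations reduce it. -/
noncomputable def slipRate (F : Flow) (t : ℝ) : ℝ → ℝ := fun s =>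
  -tanDeriv (F.z t) (F.H t) s - F.slip t s * F.stretchP t s

variable {F : Flow} {T g M : ℝ}

namespace Bounds

variable (hb : F.Bounds T M) {t : ℝ}
include hb

theorem pos : 0 < M :=
  ENNReal.ofReal_pos.1 (bot_le.trans_lt hb.2)

theorem wNorm_add_wNorm_le (ht : t ∈ Ico 0 T) :
    wNorm 2 (F.z t) (F.vp t) + wNorm 2 (F.z t) (F.H t) ≤ ENNReal.ofReal M :=
  (le_iSup₂ (f := fun t (_ : t ∈ Ico 0 T) =>
    wNorm 2 (F.z t) (F.vp t) + wNorm 2 (F.z t) (F.H t)) t ht).trans hb.2.le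

theorem wNorm_vp_le (ht : t ∈ Ico 0 T) : wNorm 2 (F.z t) (F.vp t) ≤ ENNReal.ofReal M :=
  le_self_add.trans (hb.wNorm_add_wNorm_le ht)

theorem wNorm_H_le (ht : t ∈ Ico 0 T) : wNorm 2 (F.z t) (F.H t) ≤ ENNReal.ofReal M :=
  le_add_self.trans (hb.wNorm_add_wNorm_le ht)

theorem exists_lipschitzWith_tanDeriv_vp (ht : t ∈ Ico 0 T) :
    ∃ K, LipschitzWith K (tanDeriv (F.z t) (F.vp t)) :=
  (hb.1 t ht).1 1 one_lt_two

theorem exists_lipschitzWith_tanDeriv_H (ht : t ∈ Ico 0 T) :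
    ∃ K, LipschitzWith K (tanDeriv (F.z t) (F.H t)) :=
  (hb.1 t ht).2 1 one_lt_two

theorem abs_H_le (ht : t ∈ Ico 0 T) (s : ℝ) : |F.H t s| ≤ M :=
  (hb.1 t ht).2.norm_iterate_tanDeriv_le (i := 0) two_pos hb.pos.le (hb.wNorm_H_le ht) s

theorem abs_tanDeriv_H_le (ht : t ∈ Ico 0 T) (s : ℝ) : |tanDeriv (F.z t) (F.H t) s| ≤ M :=
  (hb.1 t ht).2.norm_iterate_tanDeriv_le (i := 1) one_lt_two hb.pos.le (hb.wNorm_H_le ht) s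

theorem norm_tanDeriv_vp_le (ht : t ∈ Ico 0 T) (s : ℝ) : ‖tanDeriv (F.z t) (F.vp t) s‖ ≤ M :=
  (hb.1 t ht).1.norm_iterate_tanDeriv_le (i := 1) one_lt_two hb.pos.le (hb.wNorm_vp_le ht) s

theorem ae_norm_tanDeriv_tanDeriv_vp_le (ht : t ∈ Ico 0 T) :
    ∀ᵐ s, ‖tanDeriv (F.z t) (tanDeriv (F.z t) (F.vp t)) s‖ ≤ M :=
  ae_norm_iterate_tanDeriv_le (i := 2) le_rfl hb.pos.le (hb.wNorm_vp_le ht)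

theorem ae_abs_tanDeriv_tanDeriv_H_le (ht : t ∈ Ico 0 T) :
    ∀ᵐ s, |tanDeriv (F.z t) (tanDeriv (F.z t) (F.H t)) s| ≤ M :=
  ae_norm_iterate_tanDeriv_le (i := 2) le_rfl hb.pos.le (hb.wNorm_H_le ht)

end Bounds

namespace IsSolution

variable (hF : F.IsSolution T g) {t : ℝ}
include hF

section Interface

theorem θ_mem_closure (s : ℝ) : F.θ s ∈ closure (F.Ωm 0) :=
  (hF.Γ_initial.subset (mem_range_self s)).2

theorem z_mem_closure_m (ht : t ∈ Ico 0 T) (s : ℝ) : F.z t s ∈ closure (F.Ωm t) :=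
  hF.η_mem t ht _ (hF.θ_mem_closure s)

theorem z_mem_closure_p (ht : t ∈ Ico 0 T) (s : ℝ) : F.z t s ∈ closure (F.Ωp t) :=
  (hF.normal_p t ht s).mem_closure

theorem deriv_z_ne_zero (ht : t ∈ Ico 0 T) (s : ℝ) : deriv (F.z t) s ≠ 0 := fun h => by
  have hn : ‖F.n t s‖ = 1 := (hF.normal_p t ht s).1
  rw [n, unitNormal, norm_perp, unitTangent, tanDeriv, h, smul_zero, norm_zero] at hn
  exact zero_ne_one hn

theorem speed_pos (ht : t ∈ Ico 0 T) (s : ℝ) : 0 < F.speed t s :=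
  norm_pos_iff.2 (hF.deriv_z_ne_zero ht s)

theorem norm_τ (ht : t ∈ Ico 0 T) (s : ℝ) : ‖F.τ t s‖ = 1 :=
  norm_unitTangent (hF.deriv_z_ne_zero ht s)

theorem phase_p : IsEulerPhase T g F.Ωp F.up F.pp :=
  ⟨hF.Ωp_spaceTime, hF.up_C1, hF.pp_C1, hF.momentum_p⟩

theorem phase_m : IsEulerPhase T g F.Ωm F.um F.pm :=
  ⟨hF.Ωm_spaceTime, hF.um_C1, hF.pm_C1, hF.momentum_m⟩

theorem isC1On_z : IsC1On (Function.uncurry F.z) (Ico 0 T ×ˢ univ) := hF.η_C1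

theorem isC1On_vp : IsC1On (Function.uncurry F.vp) (Ico 0 T ×ˢ univ) :=
  hF.phase_p.velocity.comp (IsC1On.fst.prodMk hF.isC1On_z)
    fun q hq => ⟨hq.1, hF.z_mem_closure_p hq.1 q.2⟩

theorem isC1On_vm : IsC1On (Function.uncurry F.vm) (Ico 0 T ×ˢ univ) :=
  hF.phase_m.velocity.comp (IsC1On.fst.prodMk hF.isC1On_z)
    fun q hq => ⟨hq.1, hF.z_mem_closure_m hq.1 q.2⟩

theorem isC1On_δv : IsC1On (Function.uncurry F.δv) (Ico 0 T ×ˢ univ) :=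
  hF.isC1On_vp.sub hF.isC1On_vm

theorem continuousOn_speed : ContinuousOn (Function.uncurry F.speed) (Ico 0 T ×ˢ univ) :=
  hF.isC1On_z.continuousOn_deriv_slice.norm

theorem continuousOn_tanDeriv {f : ℝ → ℝ → Plane}
    (hf : IsC1On (Function.uncurry f) (Ico 0 T ×ˢ univ)) :
    ContinuousOn (Function.uncurry fun t => tanDeriv (F.z t) (f t)) (Ico 0 T ×ˢ univ) :=
  (hF.continuousOn_speed.inv₀ fun q hq => (hF.speed_pos hq.1 q.2).ne').smul
    hf.continuousOn_deriv_slice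

theorem continuousOn_τ : ContinuousOn (Function.uncurry F.τ) (Ico 0 T ×ˢ univ) :=
  hF.continuousOn_tanDeriv hF.isC1On_z

theorem continuousOn_slip : ContinuousOn (Function.uncurry F.slip) (Ico 0 T ×ˢ univ) :=
  ContinuousOn.inner (𝕜 := ℝ) hF.isC1On_δv.continuousOn hF.continuousOn_τ

theorem continuousOn_stretchP : ContinuousOn (Function.uncurry F.stretchP) (Ico 0 T ×ˢ univ) :=
  ContinuousOn.inner (𝕜 := ℝ) (hF.continuousOn_tanDeriv hF.isC1On_vp) hF.continuousOn_τ

theorem continuousOn_stretchJump :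
    ContinuousOn (Function.uncurry F.stretchJump) (Ico 0 T ×ˢ univ) :=
  ContinuousOn.inner (𝕜 := ℝ) (hF.continuousOn_tanDeriv hF.isC1On_δv) hF.continuousOn_τ

theorem differentiable_τ (ht : t ∈ Ico 0 T) : Differentiable ℝ (F.τ t) :=
  (hF.Γ_class t ht).tanDeriv.differentiable (by norm_num)
    (continuousOn_univ.1 (hF.isC1On_z.continuousOn_deriv_slice.uncurry_left t ht))
    (hF.deriv_z_ne_zero ht)

theorem norm_tanDeriv_τ (ht : t ∈ Ico 0 T) (s : ℝ) : ‖tanDeriv (F.z t) (F.τ t) s‖ = |F.H t s| :=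
  norm_tanDeriv_unitTangent (Eventually.of_forall (hF.deriv_z_ne_zero ht))
    (hF.differentiable_τ ht s)

theorem δv_eq_slip_smul_τ (ht : t ∈ Ico 0 T) (s : ℝ) : F.δv t s = F.slip t s • F.τ t s := by
  have hnormal : inner ℝ (F.δv t s) (perp (F.τ t s)) = (0 : ℝ) := hF.normal_jump t ht s
  have hframe := eq_inner_smul_add_inner_perp_smul (hF.norm_τ ht s) (F.δv t s)
  rwa [hnormal, zero_smul, add_zero] at hframe

theorem stretchJump_eq_sub (ht : t ∈ Ico 0 T) (s : ℝ) :
    F.stretchJump t s = F.stretchP t s - F.stretchM t s := by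
  simp only [stretchJump, stretchP, stretchM, ← inner_sub_left]
  rw [← tanDeriv_fun_sub (hF.isC1On_vp.differentiable_slice ht s)
    (hF.isC1On_vm.differentiable_slice ht s)]
  rfl

theorem hasDerivAt_slip (ht : t ∈ Ico 0 T) (s : ℝ) :
    HasDerivAt (F.slip t) (F.speed t s * F.stretchJump t s) s := by
  have hδ := hF.isC1On_δv.differentiable_slice ht s
  have hτ := hF.differentiable_τ ht s
  have hz := hF.deriv_z_ne_zero ht
  have htan : tanDeriv (F.z t) (F.slip t) s = F.stretchJump t s :=
    calc tanDeriv (F.z t) (F.slip t) s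
        = F.slip t s * inner ℝ (F.τ t s) (tanDeriv (F.z t) (F.τ t) s) + F.stretchJump t s := by
          rw [← real_inner_smul_left, ← hF.δv_eq_slip_smul_τ ht s]
          exact tanDeriv_inner hδ hτ
      _ = F.stretchJump t s := by
          rw [τ, inner_tanDeriv_unitTangent (Eventually.of_forall hz) hτ, mul_zero, zero_add]
  refine (hδ.inner ℝ hτ).hasDerivAt.congr_deriv ?_
  rw [← htan]
  exact deriv_eq_norm_smul_tanDeriv (F.slip t) (hz s)

end Interface

section Evolution

theorem hasDerivAt_z_time (ht : t ∈ Ioo 0 T) (s : ℝ) :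
    HasDerivAt (fun r => F.z r s) (F.vm t s) t :=
  (hF.η_deriv t (Ioo_subset_Ico_self ht) _ (hF.θ_mem_closure s)).hasDerivAt
    (Ico_mem_nhds ht.1 ht.2)

omit hF in
theorem prod_univ_mem_nhds (ht : t ∈ Ioo 0 T) (s : ℝ) : Ico 0 T ×ˢ (univ : Set ℝ) ∈ 𝓝 (t, s) :=
  prod_mem_nhds (Ico_mem_nhds ht.1 ht.2) univ_mem

theorem hasDerivAt_deriv_z_time (ht : t ∈ Ioo 0 T) (s : ℝ) :
    HasDerivAt (fun r => deriv (F.z r) s) (deriv (F.vm t) s) t := by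
  have hinterior : ∀ᶠ q : ℝ × ℝ in 𝓝 (t, s), q.1 ∈ Ioo 0 T :=
    continuous_fst.continuousAt.eventually (Ioo_mem_nhds ht.1 ht.2)
  refine hasDerivAt_partial_of_continuousAt (f := F.z) (g := F.vm) (k := fun t => deriv (F.vm t))
    ?_ ?_ ?_ (hF.isC1On_vm.continuousOn_deriv_slice.continuousAt (prod_univ_mem_nhds ht s))
  · filter_upwards [hinterior] with q hq using hF.hasDerivAt_z_time hq q.2
  · filter_upwards [hinterior] with q hq
    exact (hF.isC1On_vm.differentiable_slice (Ioo_subset_Ico_self hq) q.2).hasDerivAt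
  · filter_upwards [Ico_mem_nhds ht.1 ht.2] with r hr
    exact (hF.isC1On_z.differentiable_slice hr s).hasDerivAt

theorem hasDerivAt_speed_time (ht : t ∈ Ioo 0 T) (s : ℝ) :
    HasDerivAt (fun r => F.speed r s) (F.speed t s * F.stretchM t s) t := by
  have hz := hF.deriv_z_ne_zero (Ioo_subset_Ico_self ht) s
  refine (hasDerivAt_norm_of_ne_zero (hF.hasDerivAt_deriv_z_time ht s) hz).congr_deriv ?_
  have hstretch : F.stretchM t s
      = (F.speed t s)⁻¹ * ((F.speed t s)⁻¹ * inner ℝ (deriv (F.z t) s) (deriv (F.vm t) s)) := by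
    rw [real_inner_comm, ← real_inner_smul_right, ← real_inner_smul_left]
    rfl
  rw [hstretch, mul_inv_cancel_left₀ (hF.speed_pos (Ioo_subset_Ico_self ht) s).ne',
    div_eq_inv_mul]
  rfl

theorem exists_hasDerivAt_τ_time (ht : t ∈ Ioo 0 T) (s : ℝ) :
    ∃ τ' : Plane, HasDerivAt (fun r => F.τ r s) τ' t ∧ inner ℝ (F.τ t s) τ' = (0 : ℝ) := by
  have hτ : DifferentiableAt ℝ (fun r => F.τ r s) t :=
    ((hF.hasDerivAt_speed_time ht s).inv
      (hF.speed_pos (Ioo_subset_Ico_self ht) s).ne').smul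
        (hF.hasDerivAt_deriv_z_time ht s) |>.differentiableAt
  refine ⟨_, hτ.hasDerivAt,
    inner_deriv_eq_zero_of_norm_eq_one (f := fun r => F.τ r s) hτ.hasDerivAt ?_⟩
  filter_upwards [Ico_mem_nhds ht.1 ht.2] with r hr using hF.norm_τ hr s

theorem tanDeriv_H_eq (ht : t ∈ Ioo 0 T) (s : ℝ) :
    tanDeriv (F.z t) (F.H t) s = tanDeriv (F.z t) (fun σ => F.pp t (F.z t σ)) s
      - tanDeriv (F.z t) (fun σ => F.pm t (F.z t σ)) s := by
  have ht' := Ioo_subset_Ico_self ht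
  have hz := hF.isC1On_z.differentiable_slice ht' s
  rw [← tanDeriv_fun_sub
    (hF.phase_p.differentiableAt_pressure_trace ht (hF.z_mem_closure_p ht') hz)
    (hF.phase_m.differentiableAt_pressure_trace ht (hF.z_mem_closure_m ht') hz),
    funext (hF.pressure_jump t ht)]

theorem hasDerivAt_slip_time (ht : t ∈ Ioo 0 T) (s : ℝ) :
    HasDerivAt (fun r => F.slip r s) (F.slipRate t s) t := by
  have ht' := Ioo_subset_Ico_self ht
  have hz := hF.isC1On_z.differentiable_slice ht' s
  have hzp : HasDerivAt (fun r => F.z r s)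
      (F.up t (F.z t s) - F.slip t s • unitTangent (F.z t) s) t :=
    (hF.hasDerivAt_z_time ht s).congr_deriv <| by
      rw [← show F.τ t s = unitTangent (F.z t) s from rfl, ← hF.δv_eq_slip_smul_τ ht' s]
      exact (sub_sub_cancel _ _).symm
  have hzm : HasDerivAt (fun r => F.z r s)
      (F.um t (F.z t s) - (0 : ℝ) • unitTangent (F.z t) s) t :=
    (hF.hasDerivAt_z_time ht s).congr_deriv (by rw [zero_smul, sub_zero, vm])
  obtain ⟨vp', hvp, hp⟩ := hF.phase_p.exists_hasDerivAt_velocity_trace ht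
    (fun r => hF.z_mem_closure_p) hz hzp
  obtain ⟨vm', hvm, hm⟩ := hF.phase_m.exists_hasDerivAt_velocity_trace ht
    (fun r => hF.z_mem_closure_m) hz hzm
  obtain ⟨τ', hτ, horth⟩ := hF.exists_hasDerivAt_τ_time ht s
  have hδ : HasDerivAt (fun r => F.δv r s) (vp' - vm') t := hvp.fun_sub hvm
  refine (hδ.inner ℝ hτ).congr_deriv ?_
  rw [hF.δv_eq_slip_smul_τ ht' s, real_inner_smul_left, horth, mul_zero, zero_add, inner_sub_left,
    τ, hp, hm, slipRate, hF.tanDeriv_H_eq ht s, stretchP, τ]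
  change _ = _ - F.slip t s * inner ℝ (tanDeriv (F.z t) (fun σ => F.up t (F.z t σ)) s) _
  ring

end Evolution

section Periodicity

theorem periodic_z (t : ℝ) : Function.Periodic (F.z t) 1 := fun s => by
  simp only [z, hF.θ_periodic s]

theorem periodic_δv (t : ℝ) : Function.Periodic (F.δv t) 1 := fun s => by
  simp only [δv, vp, vm, hF.periodic_z t s]

theorem periodic_τ (t : ℝ) : Function.Periodic (F.τ t) 1 :=
  periodic_tanDeriv (hF.periodic_z t) (hF.periodic_z t)

theorem periodic_slip (t : ℝ) : Function.Periodic (F.slip t) 1 := fun s => by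
  simp only [slip, hF.periodic_δv t s, hF.periodic_τ t s]

theorem periodic_stretchJump (t : ℝ) : Function.Periodic (F.stretchJump t) 1 := fun s => by
  simp only [stretchJump, hF.periodic_τ t s,
    periodic_tanDeriv (hF.periodic_z t) (hF.periodic_δv t) s]

end Periodicity

section Bounds

theorem abs_stretchP_le (hb : F.Bounds T M) (ht : t ∈ Ico 0 T) (s : ℝ) : |F.stretchP t s| ≤ M := by
  have h := abs_real_inner_le_norm (tanDeriv (F.z t) (F.vp t) s) (F.τ t s)
  rw [hF.norm_τ ht s, mul_one] at h
  exact h.trans (hb.norm_tanDeriv_vp_le ht s)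

theorem exists_lipschitzWith_stretchP (hb : F.Bounds T M) (ht : t ∈ Ico 0 T) :
    ∃ K, LipschitzWith K (F.stretchP t) := by
  obtain ⟨K, hK⟩ := hb.exists_lipschitzWith_tanDeriv_vp ht
  obtain ⟨L, hL⟩ : ∃ L, LipschitzWith L (F.τ t) := hF.Γ_class t ht 1 (by norm_num)
  exact ⟨_, lipschitzWith_inner (A := M.toNNReal) (B := 1) hK hL
    (fun s => (hb.norm_tanDeriv_vp_le ht s).trans (Real.le_coe_toNNReal M))
    (fun s => (hF.norm_τ ht s).le)⟩

theorem ae_abs_tanDeriv_stretchP_le (hb : F.Bounds T M) (ht : t ∈ Ico 0 T) :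
    ∀ᵐ s, |tanDeriv (F.z t) (F.stretchP t) s| ≤ M + M * M := by
  obtain ⟨K, hK⟩ := hb.exists_lipschitzWith_tanDeriv_vp ht
  filter_upwards [hK.ae_differentiableAt_real, hb.ae_norm_tanDeriv_tanDeriv_vp_le ht] with s hd hs
  calc |tanDeriv (F.z t) (F.stretchP t) s|
      = |inner ℝ (tanDeriv (F.z t) (F.vp t) s) (tanDeriv (F.z t) (F.τ t) s)
          + inner ℝ (tanDeriv (F.z t) (tanDeriv (F.z t) (F.vp t)) s) (F.τ t s)| :=
        congrArg _ (tanDeriv_inner hd (hF.differentiable_τ ht s))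
    _ ≤ ‖tanDeriv (F.z t) (F.vp t) s‖ * ‖tanDeriv (F.z t) (F.τ t) s‖
          + ‖tanDeriv (F.z t) (tanDeriv (F.z t) (F.vp t)) s‖ * ‖F.τ t s‖ :=
        (abs_add_le _ _).trans
          (add_le_add (abs_real_inner_le_norm _ _) (abs_real_inner_le_norm _ _))
    _ = ‖tanDeriv (F.z t) (tanDeriv (F.z t) (F.vp t)) s‖
          + ‖tanDeriv (F.z t) (F.vp t) s‖ * |F.H t s| := by
        rw [hF.norm_τ ht s, mul_one, hF.norm_tanDeriv_τ ht s, add_comm]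
    _ ≤ M + M * M :=
        add_le_add hs (mul_le_mul (hb.norm_tanDeriv_vp_le ht s) (hb.abs_H_le ht s)
          (abs_nonneg _) hb.pos.le)

theorem exists_abs_slip_le (hT : 0 < T) (hb : F.Bounds T M) :
    ∃ C, ∀ t ∈ Ico 0 T, ∀ s, |F.slip t s| ≤ C := by
  obtain ⟨C₀, hC₀⟩ := exists_norm_le_of_periodic (hF.periodic_slip 0) one_ne_zero
    (continuousOn_univ.1 (hF.continuousOn_slip.uncurry_left 0 (left_mem_Ico.2 hT)))
  refine ⟨gronwallBound (C₀ + 1) M M (T - 0), fun t ht s => ?_⟩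
  refine norm_le_gronwallBound_of_mem_Ico (f := fun r => F.slip r s) hb.pos.le hb.pos.le
    (hF.continuousOn_slip.uncurry_right s (mem_univ s))
    (fun r hr => hF.hasDerivAt_slip_time hr s) ((hC₀ s).trans_lt (lt_add_one C₀))
    (fun r hr => ?_) ht
  have hr := Ioo_subset_Ico_self hr
  calc |F.slipRate r s|
      ≤ |tanDeriv (F.z r) (F.H r) s| + |F.slip r s| * |F.stretchP r s| := by
        rw [← abs_mul, ← abs_neg (tanDeriv _ _ s)]
        exact abs_sub _ _
    _ ≤ M + |F.slip r s| * M :=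
        add_le_add (hb.abs_tanDeriv_H_le hr s)
          (mul_le_mul_of_nonneg_left (hF.abs_stretchP_le hb hr s) (abs_nonneg _))
    _ = M * ‖F.slip r s‖ + M := by rw [Real.norm_eq_abs]; ring

theorem c6_lt_top (hT : 0 < T) (hb : F.Bounds T M) : F.c6 T < ⊤ := by
  obtain ⟨C, hC⟩ := hF.exists_abs_slip_le hT hb
  refine lt_of_le_of_lt (iSup₂_le (a := ENNReal.ofReal (2 * M + (C * (M + M * M) + M)))
    fun t ht => ?_) ENNReal.ofReal_lt_top
  rw [eLpNorm_exponent_top]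
  refine eLpNormEssSup_le_of_ae_bound ?_
  filter_upwards [hF.ae_abs_tanDeriv_stretchP_le hb ht, hb.ae_abs_tanDeriv_tanDeriv_H_le ht]
    with s hstretch hH
  rw [Real.norm_of_nonneg (by positivity)]
  refine add_le_add ?_ ((abs_add_le _ _).trans (add_le_add ?_ hH))
  · rw [coeffA, abs_mul, abs_two]
    exact mul_le_mul_of_nonneg_left (hF.abs_stretchP_le hb ht s) zero_le_two
  · rw [abs_mul]
    exact mul_le_mul (hC t ht s) hstretch (abs_nonneg _) ((abs_nonneg _).trans (hC t ht s))

omit hF in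
theorem ae_coeffA_add_forcing_le (hc : F.c6 T < ⊤) (ht : t ∈ Ico 0 T) :
    ∀ᵐ s, 2 * |F.stretchP t s| + |F.forcing t s| ≤ (F.c6 T).toReal := by
  have hle := le_iSup₂ (f := fun t (_ : t ∈ Ico 0 T) =>
    eLpNorm (fun s => |F.coeffA t s| + |F.forcing t s|) ∞ volume) t ht
  filter_upwards [ae_norm_le_of_eLpNorm_top_le ENNReal.toReal_nonneg
    (hle.trans_eq (ENNReal.ofReal_toReal hc.ne).symm)] with s hs
  rw [Real.norm_of_nonneg (by positivity), coeffA, abs_mul, abs_two] at hs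
  exact hs

theorem two_mul_abs_stretchP_le (hc : F.c6 T < ⊤) (ht : t ∈ Ico 0 T) (s : ℝ) :
    2 * |F.stretchP t s| ≤ (F.c6 T).toReal := by
  have hcont : Continuous (F.stretchP t) :=
    continuousOn_univ.1 (hF.continuousOn_stretchP.uncurry_left t ht)
  refine forall_of_ae_of_isClosed (μ := volume)
    (isClosed_le (hcont.abs.const_mul 2) continuous_const) ?_ s
  filter_upwards [ae_coeffA_add_forcing_le hc ht] with s hs
  linarith [abs_nonneg (F.forcing t s)]

end Bounds

section Comparison

theorem absolutelyContinuousOnInterval_slipRate (hb : F.Bounds T M) (ht : t ∈ Ico 0 T) (x y : ℝ) :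
    AbsolutelyContinuousOnInterval (F.slipRate t) x y := by
  obtain ⟨K, hK⟩ := hb.exists_lipschitzWith_tanDeriv_H ht
  obtain ⟨L, hL⟩ := hF.exists_lipschitzWith_stretchP hb ht
  have hslip : ContDiff ℝ 1 (F.slip t) := by
    refine contDiff_one_iff_deriv.2 ⟨fun s => (hF.hasDerivAt_slip ht s).differentiableAt, ?_⟩
    rw [funext fun s => (hF.hasDerivAt_slip ht s).deriv]
    exact (continuousOn_univ.1 (hF.continuousOn_speed.uncurry_left t ht)).mul
      (continuousOn_univ.1 (hF.continuousOn_stretchJump.uncurry_left t ht))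
  exact hK.lipschitzOnWith.absolutelyContinuousOnInterval.neg.sub
    (hslip.contDiffOn.absolutelyContinuousOnInterval.mul
      hL.lipschitzOnWith.absolutelyContinuousOnInterval)

theorem ae_deriv_slipRate_eq (hb : F.Bounds T M) (ht : t ∈ Ico 0 T) :
    ∀ᵐ s, deriv (F.slipRate t) s
      = -(F.speed t s * (F.forcing t s + F.stretchP t s * F.stretchJump t s)) := by
  obtain ⟨K, hK⟩ := hb.exists_lipschitzWith_tanDeriv_H ht
  obtain ⟨L, hL⟩ := hF.exists_lipschitzWith_stretchP hb ht
  filter_upwards [hK.ae_differentiableAt_real, hL.ae_differentiableAt_real] with s hH ha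
  have hz := hF.deriv_z_ne_zero ht s
  refine (hH.hasDerivAt.fun_neg.fun_sub
    ((hF.hasDerivAt_slip ht s).fun_mul ha.hasDerivAt)).deriv.trans ?_
  rw [deriv_eq_norm_smul_tanDeriv (tanDeriv (F.z t) (F.H t)) hz,
    deriv_eq_norm_smul_tanDeriv (F.stretchP t) hz, smul_eq_mul, smul_eq_mul, forcing, ← slip, speed]
  ring

theorem mul_sub_le_slipRate_sub (hb : F.Bounds T M) (hc : F.c6 T < ⊤) (ht : t ∈ Ico 0 T)
    {x y κ : ℝ} (hxy : x ≤ y) (hκ : ∀ σ ∈ Icc x y, κ ≤ F.speed t σ *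
      (2 * |F.stretchP t σ| - (F.c6 T).toReal - F.stretchP t σ * F.stretchJump t σ)) :
    κ * (y - x) ≤ F.slipRate t y - F.slipRate t x := by
  refine mul_sub_le_of_ae_le_deriv hxy (hF.absolutelyContinuousOnInterval_slipRate hb ht x y) ?_
  filter_upwards [hF.ae_deriv_slipRate_eq hb ht, ae_coeffA_add_forcing_le hc ht]
    with σ hderiv hcoeff hσ
  rw [hderiv, ← mul_neg]
  refine (hκ σ hσ).trans (mul_le_mul_of_nonneg_left ?_ (hF.speed_pos ht σ).le)
  linarith [le_abs_self (F.forcing t σ)]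

theorem eventually_mul_sub_le_speed_mul_stretchJump_sub (hb : F.Bounds T M) (hc : F.c6 T < ⊤)
    (ht : t ∈ Ioo 0 T) (s : ℝ) {κ : ℝ} (hκ : κ < F.speed t s *
      (2 * |F.stretchP t s| - (F.c6 T).toReal - F.stretchP t s * F.stretchJump t s)) :
    ∀ᶠ r in 𝓝[>] t, κ * (r - t) ≤
      F.speed r s * F.stretchJump r s - F.speed t s * F.stretchJump t s := by
  have hcont : ContinuousAt (fun q : ℝ × ℝ => F.speed q.1 q.2 * (2 * |F.stretchP q.1 q.2|
      - (F.c6 T).toReal - F.stretchP q.1 q.2 * F.stretchJump q.1 q.2)) (t, s) :=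
    (hF.continuousOn_speed.mul (((hF.continuousOn_stretchP.abs.const_mul 2).sub
      continuousOn_const).sub (hF.continuousOn_stretchP.mul hF.continuousOn_stretchJump)))
      |>.continuousAt (prod_univ_mem_nhds ht s)
  obtain ⟨δ, hδ, hball⟩ := Metric.eventually_nhds_iff.1 (hcont.eventually (lt_mem_nhds hκ))
  filter_upwards [Ioo_mem_nhdsGT (lt_min (lt_add_of_pos_right t hδ) ht.2)] with r hr
  obtain ⟨hrδ, hrT⟩ := lt_min_iff.1 hr.2
  have hsub : ∀ ρ ∈ Icc t r, ρ ∈ Ioo 0 T := fun ρ hρ => ⟨ht.1.trans_le hρ.1, hρ.2.trans_lt hrT⟩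
  refine mul_sub_le_partial_sub (p := fun r => F.speed r s * F.stretchJump r s) hδ hr.1.le
    (fun ρ hρ σ => hF.hasDerivAt_slip_time (hsub ρ hρ) σ) (fun ρ hρ h hh => ?_)
    (fun ρ hρ => hF.hasDerivAt_slip (Ioo_subset_Ico_self (hsub ρ hρ)) s)
  have hnear : ∀ σ ∈ Icc s (s + h), dist (ρ, σ) (t, s) < δ := fun σ hσ => by
    rw [Prod.dist_eq, Real.dist_eq, Real.dist_eq, abs_of_nonneg (sub_nonneg.2 hρ.1),
      abs_of_nonneg (sub_nonneg.2 hσ.1)]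
    exact max_lt (by linarith [hρ.2]) (by linarith [hσ.2, hh.2])
  simpa only [add_sub_cancel_left] using hF.mul_sub_le_slipRate_sub hb hc
    (Ioo_subset_Ico_self (hsub ρ hρ)) (le_add_of_nonneg_right hh.1.le)
    fun σ hσ => (hball (hnear σ hσ)).le

theorem isRiccatiSupersolution (hb : F.Bounds T M) (hc : F.c6 T < ⊤) (s : ℝ) :
    IsRiccatiSupersolution 0 T (F.c6 T).toReal (fun t => F.speed t s) (fun t => F.stretchP t s)
      (fun t => F.stretchJump t s) where
  continuousOn := hF.continuousOn_stretchJump.uncurry_right s (mem_univ s)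
  hasDerivAt t ht := (hF.hasDerivAt_speed_time ht s).congr_deriv <| by
    rw [hF.stretchJump_eq_sub (Ioo_subset_Ico_self ht), sub_sub_cancel]
  pos t ht := hF.speed_pos (Ioo_subset_Ico_self ht) s
  two_mul_abs_le t ht := hF.two_mul_abs_stretchP_le hc (Ioo_subset_Ico_self ht) s
  slope t ht _ hκ := hF.eventually_mul_sub_le_speed_mul_stretchJump_sub hb hc ht s hκ

theorem exists_neg_le_stretchJump (hT : 0 < T) (hb : F.Bounds T M) (hc : F.c6 T < ⊤) :
    ∃ C, ∀ t ∈ Ioo 0 T, ∀ s, -C ≤ F.stretchJump t s := by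
  obtain ⟨C₀, hC₀⟩ := exists_norm_le_of_periodic (hF.periodic_stretchJump 0) one_ne_zero
    (continuousOn_univ.1 (hF.continuousOn_stretchJump.uncurry_left 0 (left_mem_Ico.2 hT)))
  have hC₀_nonneg : 0 ≤ C₀ := (norm_nonneg _).trans (hC₀ 0)
  have hc_nonneg : 0 ≤ (F.c6 T).toReal := ENNReal.toReal_nonneg
  refine ⟨C₀ + ((F.c6 T).toReal + 1), fun t ht s => ?_⟩
  refine (hF.isRiccatiSupersolution hb hc s).neg_le (le_add_of_nonneg_left hC₀_nonneg) ?_ ht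
  linarith [(abs_le.1 (hC₀ s)).1]

theorem abs_stretchM_le (hb : F.Bounds T M) (hc : F.c6 T < ⊤) (ht : t ∈ Ioo 0 T) {s : ℝ}
    (hlow : -(T - t)⁻¹ ≤ F.stretchJump t s) :
    |F.stretchM t s| ≤ (1 + (1 + 2 * (F.c6 T).toReal) * (T - t)) / (T - t) := by
  have ht' := Ioo_subset_Ico_self ht
  have hc_nonneg : 0 ≤ (F.c6 T).toReal := ENNReal.toReal_nonneg
  have hup := (hF.isRiccatiSupersolution hb hc s).le_inv_add ht
  have hP := hF.two_mul_abs_stretchP_le hc ht' s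
  rw [add_div, mul_div_cancel_right₀ _ (sub_pos.2 ht.2).ne', one_div, abs_le]
  constructor <;>
    linarith [hF.stretchJump_eq_sub ht' s, le_abs_self (F.stretchP t s),
      neg_abs_le (F.stretchP t s)]

theorem eventually_eLpNorm_stretchM_le (hT : 0 < T) (hb : F.Bounds T M) :
    ∀ᶠ t in 𝓝[<] T, eLpNorm (F.stretchM t) ∞ volume ≤
      ENNReal.ofReal ((1 + (1 + 2 * (F.c6 T).toReal) * (T - t)) / (T - t)) := by
  have hc := hF.c6_lt_top hT hb
  obtain ⟨C, hC⟩ := hF.exists_neg_le_stretchJump hT hb hc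
  filter_upwards [(tendsto_inv_sub_nhdsLT T).eventually_ge_atTop C, Ioo_mem_nhdsLT hT] with t hCt ht
  rw [eLpNorm_exponent_top]
  exact eLpNormEssSup_le_of_ae_bound <| Eventually.of_forall fun s =>
    hF.abs_stretchM_le hb hc ht ((neg_le_neg hCt).trans (hC t ht s))

end Comparison

end IsSolution

end Flow

end VortexSheet

theorem corollary1_general (F : VortexSheet.Flow) (T g M : ℝ) (hT : 0 < T)
    (hF : F.IsSolution T g) (hbounds : F.Bounds T M) :
    F.c6 T < ⊤ ∧
      ∀ ε : ℝ, 0 < ε → ∃ t₀ ∈ Set.Ico (T - ε) T, ∀ t ∈ Set.Ico t₀ T,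
        MeasureTheory.eLpNorm (F.stretchM t) ⊤ MeasureTheory.volume ≤
          ENNReal.ofReal ((1 + (1 + 2 * (F.c6 T).toReal) * (T - t)) / (T - t)) := by
  refine ⟨hF.c6_lt_top hT hbounds, fun ε hε => ?_⟩
  obtain ⟨l, hl, hbound⟩ :=
    mem_nhdsLT_iff_exists_Ico_subset.1 (hF.eventually_eLpNorm_stretchM_le hT hbounds)
  exact ⟨max (T - ε) l, ⟨le_max_left _ _, max_lt (sub_lt_self T hε) hl⟩,
    fun t ht => hbound ⟨(le_max_right _ _).trans ht.1, ht.2⟩⟩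

theorem corollary1 (F : VortexSheet.Flow) (T g M : ℝ) (hT : 0 < T)
    (hF : F.IsSolution T g) (hbounds : F.Bounds T M) (hblow : F.BlowUp T) :
    F.c6 T < ⊤ ∧
      ∀ ε : ℝ, 0 < ε → ε ≤ T → ∃ t₀ ∈ Set.Ico (T - ε) T, ∀ t ∈ Set.Ico t₀ T,
        MeasureTheory.eLpNorm (F.stretchM t) ⊤ MeasureTheory.volume ≤
          ENNReal.ofReal ((1 + (1 + 2 * (F.c6 T).toReal) * (T - t)) / (T - t)) := by
  obtain ⟨hc, hrate⟩ := corollary1_general F T g M hT hF hbounds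
  exact ⟨hc, fun ε hε _ => hrate ε hε⟩
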